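/- Let $k>1$ and let $L\subseteq\{a_1,\dots,a_k\}^*$ be an arbitrary language over an alphabet with $k$ letters (in particular, for $k=2$, an arbitrary binary language). Then there are a probabilistic Turing machine (PTM) verifier $V$, a constant $K$ and an error bound $\varepsilon$ with $0\le\varepsilon<\tfrac12$ such that 1. (linear space) for every input $w$ and every prover, the number of work tape cells that $V$ visits with nonzero probability is at most $K(|w|+1)$; 2. (completeness) there is a prover $P$ such that every $w\in L$ is accepted by $V$ with probability at least $1-\varepsilon$ when $V$ communicates with $P$; 3. (soundness) every $w\notin L$ is rejected by $V$ (that is, $V$ halts and rejects) with probability at least $1-\varepsilon$ when $V$ communicates with any prover $P^*$ whatsoever. Here a PTM verifier has a read-only two-way input tape holding the input between two end-markers, one read/write work tape that is initially blank, and a communication cell holding one symbol. Its state set is finite and consists of reading states (among them the initial state), communicating states, one accepting and one rejecting halting state; its work tape alphabet and communication alphabet are finite. In a reading state, the state and the symbols under the two heads determine a probability distribution, with arbitrary real probabilities, on the next state, the symbol written on the work tape, and the moves (left, stay, right) of the two heads. In a communicating state $s$, $V$ writes a symbol determined by $s$ on the communication cell, the prover replies with a symbol $\tau$, and $V$ enters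 a state determined by $s$ and $\tau$. A prover is an arbitrary function (not necessarily computable) that maps the input and the sequence of symbols written by $V$ on the communication cell so far to the next reply; it does not see the random choices of $V$. -/

import Mathlib

/-- Head movements: one cell to the left, no movement, one cell to the right. -/
inductive HeadMove where
  | left
  | stay
  | right

/-- The symbols on the input tape: the two end-markers and the letters of the input alphabet. -/
inductive InputSymbol (A : Type) where
  | leftEnd
  | letter (a : A)
  | rightEnd

/-- The states of a verifier: the reading states `R`, the communicating states `C`, and the two
halting states. -/
inductive VerifierState (R C : Type) where
  | reading (r : R)
  | communicating (c : C)
  | accept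
  | reject

/-- A probabilistic Turing machine verifier with input alphabet `A`: a read-only two-way input tape,
one read/write work tape, and a communication cell. The symbol `none : Option Γ` is the blank.
The transition probabilities are arbitrary real numbers in `[0,1]`. -/
structure PTMVerifier (A : Type) where
  /-- The reading states. -/
  R : Type
  /-- The communicating states. -/
  C : Type
  /-- The work tape alphabet, without the blank. -/
  Γ : Type
  /-- The communication alphabet. -/
  Υ : Type
  finite_R : Finite R
  finite_C : Finite C
  finite_Γ : Finite Γ
  finite_Υ : Finite Υ
  nonempty_Υ : Nonempty Υ
  /-- The initial state, a reading state. -/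
  start : R
  /-- In a reading state: the distribution of the next state, the symbol written on the work tape,
  the move of the input head and the move of the work head, given the state and the symbols
  under the input head and under the work head. -/
  readTrans : R → InputSymbol A → Option Γ →
    PMF (VerifierState R C × Option Γ × HeadMove × HeadMove)
  /-- The symbol that the verifier writes on the communication cell in a communicating state. -/
  message : C → Υ
  /-- The next state, given the communicating state and the reply of the prover. -/
  commTrans : C → Υ → VerifierState R C

/-- The symbol in cell `i` of the input tape, which holds the word `w` in the cells
`1, ..., w.length`, between the left end-marker (cell `0`) and the right end-marker. -/
def inputSymbolAt {A : Type} (w : List A) : ℕ → InputSymbol A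
  | 0 => .leftEnd
  | j + 1 =>
    match w[j]? with
    | some a => .letter a
    | none => .rightEnd

/-- Movement of the input head on the cells `0, ..., n + 1`, where `n` is the length of the input;
the head does not leave the tape segment between the end-markers (a move beyond an end-marker
has no effect). -/
def moveInputHead (n : ℕ) (i : ℕ) : HeadMove → ℕ
  | .left => i - 1
  | .stay => i
  | .right => min (i + 1) (n + 1)

/-- Movement of the work head on the two-way infinite work tape. -/
def moveWorkHead (z : ℤ) : HeadMove → ℤ
  | .left => z - 1
  | .stay => z
  | .right => z + 1

namespace PTMVerifier

variable {A : Type}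

/-- A prover strategy for communication with `V`: its next reply is an arbitrary function of the
input and of the sequence of symbols that the verifier has written on the communication cell so
far (most recent symbol first). It has no other access to the computation: the coins of the
verifier are private. -/
def Prover (V : PTMVerifier A) : Type := List A → List V.Υ → V.Υ

/-- A configuration, with the list of all symbols that the verifier has sent so far (most recent
symbol first). -/
structure Config (V : PTMVerifier A) where
  state : VerifierState V.R V.C
  inputHead : ℕ
  tape : ℤ → Option V.Γ
  workHead : ℤ
  sent : List V.Υ

/-- The initial configuration: the input head is on the left end-marker and the work tape is
blank. -/
def startConfig (V : PTMVerifier A) : V.Config where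
  state := .reading V.start
  inputHead := 0
  tape := fun _ => none
  workHead := 0
  sent := []

/-- One step of the computation of `V` on the input `w` with the prover `P`. In a halting state
nothing changes any more. -/
noncomputable def step (V : PTMVerifier A) (P : V.Prover) (w : List A) (c : V.Config) :
    PMF V.Config :=
  match c.state with
  | .reading r =>
      (V.readTrans r (inputSymbolAt w c.inputHead) (c.tape c.workHead)).map fun o =>
        { state := o.1
          inputHead := moveInputHead w.length c.inputHead o.2.2.1
          tape := Function.update c.tape c.workHead o.2.1
          workHead := moveWorkHead c.workHead o.2.2.2
          sent := c.sent }
  | .communicating q =>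
      PMF.pure
        { c with
          state := V.commTrans q (P w (V.message q :: c.sent))
          sent := V.message q :: c.sent }
  | .accept => PMF.pure c
  | .reject => PMF.pure c

/-- The distribution of the configuration after `t` steps. -/
noncomputable def run (V : PTMVerifier A) (P : V.Prover) (w : List A) : ℕ → PMF V.Config
  | 0 => PMF.pure V.startConfig
  | t + 1 => (V.run P w t).bind (V.step P w)

/-- The probability that `V`, on the input `w` with the prover `P`, halts in the accepting state:
the limit (supremum) over `t` of the probability of having accepted within `t` steps. -/
noncomputable def acceptProb (V : PTMVerifier A) (P : V.Prover) (w : List A) : ENNReal :=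
  ⨆ t : ℕ, (V.run P w t).toOuterMeasure {c | c.state = .accept}

/-- The probability that `V`, on the input `w` with the prover `P`, halts in the rejecting state. -/
noncomputable def rejectProb (V : PTMVerifier A) (P : V.Prover) (w : List A) : ENNReal :=
  ⨆ t : ℕ, (V.run P w t).toOuterMeasure {c | c.state = .reject}

/-- The space used by `V` on the input `w` with the prover `P`: the number of work tape cells that
are visited with nonzero probability. -/
noncomputable def spaceUsed (V : PTMVerifier A) (P : V.Prover) (w : List A) : ℕ∞ :=
  Set.encard {z : ℤ | ∃ t : ℕ, ∃ c ∈ (V.run P w t).support, c.workHead = z}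

/-- `V` is a linear-space verifier: with every prover and on every input of length `n`, it uses at
most `K * (n + 1)` cells, for a constant `K`. (The summand `1` is there for the empty input, on
which at least one cell is visited.) -/
def IsLinearSpace (V : PTMVerifier A) : Prop :=
  ∃ K : ℕ, ∀ (P : V.Prover) (w : List A), V.spaceUsed P w ≤ ((K * (w.length + 1) : ℕ) : ℕ∞)

/-- The language `L` is verifiable by `V` with error `ε`: with some honest prover, `V` accepts
each member with probability at least `1 - ε`, and with every prover, `V` rejects each non-member
with probability at least `1 - ε`. -/
def VerifiesWithError (V : PTMVerifier A) (L : Language A) (ε : ℝ) : Prop :=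
  (∃ P : V.Prover, ∀ w ∈ L, ENNReal.ofReal (1 - ε) ≤ V.acceptProb P w) ∧
    ∀ w ∉ L, ∀ P : V.Prover, ENNReal.ofReal (1 - ε) ≤ V.rejectProb P w

/-- The language `L` is verified by `V` with bounded error: with some error bound `ε < 1/2`. -/
def VerifiesWithBoundedError (V : PTMVerifier A) (L : Language A) : Prop :=
  ∃ ε : ℝ, 0 ≤ ε ∧ ε < 1 / 2 ∧ V.VerifiesWithError L ε

end PTMVerifier

/-! The language is stored in the bias of a coin. With `b = base k + 1`, the bias has base `b`
digits 1 or 2, and the word `w` owns the digit with index `M = wordIndex w + 1`, which is 2 exactly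
for members. After `b ^ (7 * M)` tosses the number of heads is, by Chebyshev, so close to its mean
that its digit with weight `b ^ (6 * M - 1)` is this digit of the bias (`digit_of_abs_lt`,
`one_sub_goodProb_le`).

The two counters, for tosses and for heads, have `7 * M` digits each, exponentially many in `|w|`,
so the prover has to keep them. After every toss it dictates both, lowest digits first, in seven
phases of `M` digits. The work tape holds only a position below `M` and a secret random target, both
with `|w|` digits in base `k + 1`. The verifier remembers the seven digit pairs at the target and
checks that they change as an increment requires. The messages do not depend on the target, so the
first false digit is caught for the one target that is congruent to its place modulo `M`
(`sum_val_query_ge`). The target is uniform among `B = (k + 1) ^ |w|` numbers, so a lie may be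
caught with probability as small as `1 / B`.

This is amplified by repetition. A repetition that ends in favour of membership leads to acceptance
only with probability `q = θ.gate ^ M ≤ 1 / (6 * B)`, and to a restart otherwise; hence a lying
prover is likely to be caught before it is believed. A prover that never lets the counter wrap
around is defeated by a rejection with probability `θ.clock ^ M = b ^ (-8 * M)` before each toss,
which costs an honest prover at most `b ^ (-M)` per repetition.

Probabilities of halting in a given state are bounded through one-step equations. The infimum `r`
over all situations at the start of a repetition satisfies a recursive inequality
(`soundness_bound`, `completeness_bound`). The chances of stopping make these inequalities strong
enough to force `r ≥ 3 / 4`. -/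

/-- A coin that shows `true` with probability `p`. -/
noncomputable def coin (p : unitInterval) : PMF Bool :=
  PMF.ofFintype (fun b => ENNReal.ofReal (cond b (p : ℝ) (1 - p))) (by
    rw [Fintype.sum_bool, cond_true, cond_false,
      ← ENNReal.ofReal_add p.2.1 (sub_nonneg.2 p.2.2)]
    simp)

theorem coin_toReal (p : unitInterval) (b : Bool) :
    (coin p b).toReal = cond b (p : ℝ) (1 - p) := by
  rw [coin, PMF.ofFintype_apply, ENNReal.toReal_ofReal]
  cases b
  · exact sub_nonneg.2 p.2.2
  · exact p.2.1

/-! ### Halting probabilities and first-step analysis -/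

namespace VerifierState

/-- The halting states. -/
def IsHalting {R C : Type} : VerifierState R C → Prop
  | .accept => True
  | .reject => True
  | _ => False

end VerifierState

namespace PTMVerifier

variable {A : Type} (V : PTMVerifier A) (P : V.Prover) (w : List A)

/-- The distribution of the configuration `t` steps after the configuration `c`. -/
noncomputable def runFrom (c : V.Config) : ℕ → PMF V.Config
  | 0 => PMF.pure c
  | t + 1 => (runFrom c t).bind (V.step P w)

theorem run_eq_runFrom (t : ℕ) : V.run P w t = V.runFrom P w V.startConfig t := by
  induction t with
  | zero => rfl
  | succ t ih => rw [run, ih]; rfl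

theorem runFrom_succ' (c : V.Config) (t : ℕ) :
    V.runFrom P w c (t + 1) = (V.step P w c).bind fun c' => V.runFrom P w c' t := by
  induction t with
  | zero => simp [runFrom]
  | succ t ih => rw [runFrom, ih, PMF.bind_bind]; rfl

/-- The probability of being in the state `h` exactly `t` steps after the configuration `c`. -/
noncomputable def hitWithin (h : VerifierState V.R V.C) (c : V.Config) (t : ℕ) : ENNReal :=
  (V.runFrom P w c t).toOuterMeasure {c | c.state = h}

theorem hitWithin_succ (h : VerifierState V.R V.C) (c : V.Config) (t : ℕ) :
    V.hitWithin P w h c (t + 1) = ∑' c', V.step P w c c' * V.hitWithin P w h c' t := by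
  rw [hitWithin, runFrom_succ', PMF.toOuterMeasure_bind_apply]
  rfl

theorem step_of_isHalting {c : V.Config} (hc : c.state.IsHalting) :
    V.step P w c = PMF.pure c := by
  obtain ⟨s, i, tp, z, m⟩ := c
  cases s <;> first | rfl | exact hc.elim

theorem hitWithin_le_succ {h : VerifierState V.R V.C} (hh : h.IsHalting) (c : V.Config) (t : ℕ) :
    V.hitWithin P w h c t ≤ V.hitWithin P w h c (t + 1) := by
  induction t generalizing c with
  | zero =>
    by_cases hc : c.state = h
    · have hs := V.step_of_isHalting P w (c := c) (hc ▸ hh)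
      simp [hitWithin, runFrom, hs]
    · simp [hitWithin, runFrom, hc]
  | succ t ih =>
    rw [hitWithin_succ, hitWithin_succ]
    exact ENNReal.tsum_le_tsum fun c' => mul_le_mul_right (ih c') _

theorem hitWithin_monotone {h : VerifierState V.R V.C} (hh : h.IsHalting) (c : V.Config) :
    Monotone (V.hitWithin P w h c) :=
  monotone_nat_of_le_succ (V.hitWithin_le_succ P w hh c)

/-- The probability of eventually being in the halting state `h` when the computation is started
in the configuration `c`. -/
noncomputable def value (h : VerifierState V.R V.C) (c : V.Config) : ℝ :=
  (⨆ t, V.hitWithin P w h c t).toReal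

theorem iSup_hitWithin_le_one (h : VerifierState V.R V.C) (c : V.Config) :
    ⨆ t, V.hitWithin P w h c t ≤ 1 := by
  refine iSup_le fun t => ?_
  refine ((V.runFrom P w c t).toOuterMeasure.mono (Set.subset_univ _)).trans ?_
  exact ((PMF.toOuterMeasure_apply_eq_one_iff _ _).2 (Set.subset_univ _)).le

theorem value_nonneg (h : VerifierState V.R V.C) (c : V.Config) : 0 ≤ V.value P w h c :=
  ENNReal.toReal_nonneg

theorem value_le_one (h : VerifierState V.R V.C) (c : V.Config) : V.value P w h c ≤ 1 :=
  ENNReal.toReal_le_of_le_ofReal zero_le_one (by simpa using V.iSup_hitWithin_le_one P w h c)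

theorem value_of_state_eq {h : VerifierState V.R V.C} {c : V.Config} (hc : c.state = h) :
    V.value P w h c = 1 := by
  refine le_antisymm (V.value_le_one P w h c) ?_
  have : 1 ≤ ⨆ t, V.hitWithin P w h c t := by
    refine le_trans ?_ (le_iSup _ 0)
    simp [hitWithin, runFrom, hc]
  have h2 := le_antisymm (V.iSup_hitWithin_le_one P w h c) this
  rw [value, h2, ENNReal.toReal_one]

/-- First-step analysis. The supremum over time passes through the finite sum because a halting
state, once reached, is never left. -/
theorem value_of_step_eq_map {h : VerifierState V.R V.C} (hh : h.IsHalting) {c : V.Config}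
    {ι : Type} [Fintype ι] (p : PMF ι) (f : ι → V.Config) (hs : V.step P w c = p.map f) :
    V.value P w h c = ∑ i, (p i).toReal * V.value P w h (f i) := by
  have h1 : ⨆ t, V.hitWithin P w h c t = ∑ i, p i * ⨆ t, V.hitWithin P w h (f i) t := by
    -- By monotonicity, discarding time 0 does not change the supremum; time `t + 1` from `c` is
    -- time `t` from its successors.
    rw [← (V.hitWithin_monotone P w hh c).iSup_nat_add 1]
    have : ∀ t, V.hitWithin P w h c (t + 1) = ∑ i, p i * V.hitWithin P w h (f i) t := by
      intro t
      rw [hitWithin, runFrom_succ', hs, PMF.bind_map, PMF.toOuterMeasure_bind_apply,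
        tsum_fintype]
      rfl
    simp_rw [this, ENNReal.mul_iSup]
    rw [ENNReal.finsetSum_iSup_of_monotone]
    intro i s t hst
    exact mul_le_mul_right (V.hitWithin_monotone P w hh _ hst) _
  rw [value, h1, ENNReal.toReal_sum]
  · simp_rw [ENNReal.toReal_mul]
    rfl
  · intro i _
    exact ENNReal.mul_ne_top (p.apply_ne_top i)
      (ne_top_of_le_ne_top ENNReal.one_ne_top (V.iSup_hitWithin_le_one P w h (f i)))

theorem value_of_step_eq_pure {h : VerifierState V.R V.C} (hh : h.IsHalting) {c c' : V.Config}
    (hs : V.step P w c = PMF.pure c') : V.value P w h c = V.value P w h c' := by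
  rw [V.value_of_step_eq_map P w hh (PMF.pure ()) (fun _ => c') (by rw [hs, PMF.pure_map])]
  simp

theorem ofReal_le_acceptProb {x : ℝ} (hx : x ≤ V.value P w .accept V.startConfig) :
    ENNReal.ofReal x ≤ V.acceptProb P w := by
  have : V.acceptProb P w = ⨆ t, V.hitWithin P w .accept V.startConfig t := by
    simp only [acceptProb, hitWithin, run_eq_runFrom]
  rw [this]
  exact ENNReal.ofReal_le_of_le_toReal hx

theorem ofReal_le_rejectProb {x : ℝ} (hx : x ≤ V.value P w .reject V.startConfig) :
    ENNReal.ofReal x ≤ V.rejectProb P w := by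
  have : V.rejectProb P w = ⨆ t, V.hitWithin P w .reject V.startConfig t := by
    simp only [rejectProb, hitWithin, run_eq_runFrom]
  rw [this]
  exact ENNReal.ofReal_le_of_le_toReal hx

end PTMVerifier

/-! ### Programs with two counters, compiled to linear-space verifiers -/

/-- An instruction of a program with states `Q` and communication alphabet `Υ`. The program works on
two numbers, a position (initially `0`) and a target. -/
inductive Instruction (Q Υ : Type) where
  /-- Send a symbol and branch on the reply. -/
  | talk (m : Υ) (next : Υ → Q)
  /-- Toss a coin with the given probability of `true`. -/
  | toss (p : unitInterval) (next : Bool → Q)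
  /-- Test whether the position equals the target and whether it equals the index of the input word,
  then reset the position in the second case and increment it otherwise. -/
  | tick (next : Bool → Bool → Q)
  /-- Choose a random target. -/
  | pick (next : Q)
  | accept
  | reject

/-- A program for a verifier. -/
structure Program where
  Q : Type
  Υ : Type
  finite_Q : Finite Q
  finite_Υ : Finite Υ
  nonempty_Υ : Nonempty Υ
  start : Q
  instr : Q → Instruction Q Υ

/-- The stages in which a verifier executes an instruction. -/
inductive Stage (Q : Type) where
  | home (q : Q)
  | incr (next : Bool → Bool → Q) (carry onTarget onIndex : Bool)
  | draw (next : Q)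
  | back (next : Q) (clear : Bool)

instance {Q : Type} [Finite Q] : Finite (Stage Q) := by
  let f : Q ⊕ ((Bool → Bool → Q) × Bool × Bool × Bool) ⊕ Q ⊕ (Q × Bool) → Stage Q := fun x =>
    match x with
    | .inl q => .home q
    | .inr (.inl (n, c, e, i)) => .incr n c e i
    | .inr (.inr (.inl n)) => .draw n
    | .inr (.inr (.inr (n, c))) => .back n c
  refine Finite.of_surjective f fun s => ?_
  cases s with
  | home q => exact ⟨.inl q, rfl⟩
  | incr n c e i => exact ⟨.inr (.inl (n, c, e, i)), rfl⟩
  | draw n => exact ⟨.inr (.inr (.inl n)), rfl⟩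
  | back n c => exact ⟨.inr (.inr (.inr (n, c))), rfl⟩

/-- The content of a work tape cell: a digit of the position and a digit of the target. -/
abbrev DigitPair (k : ℕ) : Type := Fin (k + 1) × Fin (k + 1)

/-- The symbol for a pair of digits; the blank stands for two zeros. -/
def DigitPair.encode {k : ℕ} (c : DigitPair k) : Option (DigitPair k) :=
  if c = (0, 0) then none else some c

/-- The pair of digits that a symbol stands for. -/
def DigitPair.decode {k : ℕ} (γ : Option (DigitPair k)) : DigitPair k :=
  γ.getD (0, 0)

@[simp]
theorem DigitPair.decode_encode {k : ℕ} (c : DigitPair k) : DigitPair.decode c.encode = c := by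
  unfold DigitPair.decode DigitPair.encode
  split_ifs with h <;> simp [h]

namespace Program

variable (G : Program) {k : ℕ}

/-- The verifier state in which the instruction of `q` is executed. -/
def enter (q : G.Q) : VerifierState (Stage G.Q) G.Q :=
  match G.instr q with
  | .talk _ _ => .communicating q
  | .accept => .accept
  | .reject => .reject
  | _ => .reading (.home q)

/-- The transitions of the verifier that executes the program `G`. -/
noncomputable def readTrans (r : Stage G.Q) (i : InputSymbol (Fin k))
    (γ : Option (DigitPair k)) :
    PMF (VerifierState (Stage G.Q) G.Q × Option (DigitPair k) × HeadMove × HeadMove) :=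
  match r, i with
  | .home q, .leftEnd =>
    match G.instr q with
    | .toss p next => (coin p).map fun b => (G.enter (next b), γ, .stay, .stay)
    | .tick next => PMF.pure (.reading (.incr next true true true), γ, .right, .right)
    | .pick next => PMF.pure (.reading (.draw next), γ, .right, .right)
    | _ => PMF.pure (.reject, γ, .stay, .stay)
  | .incr next c e x, .letter a =>
    -- Both equality tests below use `d.1`, the digit before the increment; the carry continues
    -- exactly when the new digit `d'` is 0. The input letter itself is the digit of the word index,
    -- so the index needs no track on the work tape.
    let d := DigitPair.decode γ
    let d' := if c then d.1 + 1 else d.1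
    PMF.pure (.reading (.incr next (c && decide (d' = 0)) (e && decide (d.1 = d.2))
      (x && decide (d.1 = a.succ))), DigitPair.encode (d', d.2), .right, .right)
  | .incr next _ e x, .rightEnd => PMF.pure (.reading (.back (next e x) x), γ, .left, .left)
  | .draw next, .letter _ =>
    (PMF.uniformOfFintype (Fin (k + 1))).map fun e =>
      (.reading (.draw next), DigitPair.encode ((DigitPair.decode γ).1, e), .right, .right)
  | .draw next, .rightEnd => PMF.pure (.reading (.back next false), γ, .left, .left)
  | .back next c, .letter _ =>
    PMF.pure (.reading (.back next c), (if c then DigitPair.encode (0, (DigitPair.decode γ).2)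
      else γ), .left, .left)
  | .back next _, .leftEnd => PMF.pure (G.enter next, γ, .stay, .stay)
  | _, _ => PMF.pure (.reject, γ, .stay, .stay)

/-- The verifier that executes the program `G`. -/
noncomputable def verifier (k : ℕ) : PTMVerifier (Fin k) where
  R := Stage G.Q
  C := G.Q
  Γ := DigitPair k
  Υ := G.Υ
  finite_R := have := G.finite_Q; inferInstance
  finite_C := G.finite_Q
  finite_Γ := inferInstance
  finite_Υ := G.finite_Υ
  nonempty_Υ := G.nonempty_Υ
  -- A verifier has to start in a reading state, but a program may start by talking; on the left
  -- end-marker this stage only enters the first instruction.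
  start := .back G.start false
  readTrans := G.readTrans
  message q := match G.instr q with
    | .talk m _ => m
    | _ => G.nonempty_Υ.some
  commTrans q τ := match G.instr q with
    | .talk _ next => G.enter (next τ)
    | _ => .reject

/-- The heads move in lockstep and never try to pass an end-marker. Hence they always stand on cells
with the same number, which yields the space bound. -/
theorem readTrans_moves {r : Stage G.Q} {i : InputSymbol (Fin k)} {γ : Option (DigitPair k)}
    {o : VerifierState (Stage G.Q) G.Q × Option (DigitPair k) × HeadMove × HeadMove}
    (ho : o ∈ (G.readTrans r i γ).support) :
    o.2.2.1 = o.2.2.2 ∧ (i = .leftEnd → o.2.2.1 ≠ .left) ∧ (i = .rightEnd → o.2.2.1 ≠ .right) := by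
  unfold readTrans at ho
  split at ho
  · split at ho <;> simp at ho
    all_goals first
      | (subst ho; simp)
      | (rcases ho with ⟨-, ho⟩ | ⟨-, ho⟩ <;> subst ho <;> simp)
  all_goals simp at ho
  all_goals first
    | (subst ho; simp)
    | (obtain ⟨_, ho⟩ := ho; subst ho; simp)

theorem heads_aligned (P : (G.verifier k).Prover) (w : List (Fin k)) (t : ℕ) :
    ∀ c ∈ ((G.verifier k).run P w t).support,
      c.workHead = c.inputHead ∧ c.inputHead ≤ w.length + 1 := by
  induction t with
  | zero =>
    intro c hc
    rw [PTMVerifier.run, PMF.support_pure, Set.mem_singleton_iff] at hc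
    subst hc
    simp [PTMVerifier.startConfig]
  | succ t ih =>
    intro c hc
    rw [PTMVerifier.run, PMF.mem_support_bind_iff] at hc
    obtain ⟨c', hc', hc⟩ := hc
    obtain ⟨h1, h2⟩ := ih c' hc'
    obtain ⟨s, i, tp, z, m⟩ := c'
    simp only at h1 h2
    subst h1
    cases s with
    | reading r =>
      rw [PTMVerifier.step] at hc
      rw [PMF.mem_support_map_iff] at hc
      obtain ⟨o, ho, rfl⟩ := hc
      obtain ⟨hm, hl, hr⟩ := G.readTrans_moves ho
      obtain ⟨o1, o2, m1, m2⟩ := o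
      simp only at hm hl hr ⊢
      subst hm
      cases m1 with
      | left =>
        cases i with
        | zero => exact absurd rfl (hl rfl)
        | succ i => exact ⟨by simp [moveWorkHead, moveInputHead], by simp [moveInputHead]; omega⟩
      | stay => exact ⟨rfl, h2⟩
      | right =>
        -- The input head would be stopped here while the work head moves on; this is the only way
        -- in which a right move could break the alignment.
        have : i ≠ w.length + 1 := by
          rintro rfl
          exact hr (by simp [inputSymbolAt]) rfl
        have : min (i + 1) (w.length + 1) = i + 1 := by omega
        exact ⟨by simp [moveWorkHead, moveInputHead, this], by simp [moveInputHead]⟩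
    | communicating q =>
      simp only [PTMVerifier.step, PMF.support_pure, Set.mem_singleton_iff] at hc
      subst hc
      exact ⟨rfl, h2⟩
    | accept =>
      simp only [PTMVerifier.step, PMF.support_pure, Set.mem_singleton_iff] at hc
      subst hc
      exact ⟨rfl, h2⟩
    | reject =>
      simp only [PTMVerifier.step, PMF.support_pure, Set.mem_singleton_iff] at hc
      subst hc
      exact ⟨rfl, h2⟩

theorem isLinearSpace (k : ℕ) : (G.verifier k).IsLinearSpace := by
  refine ⟨2, fun P w => ?_⟩
  have hsub : {z : ℤ | ∃ t : ℕ, ∃ c ∈ ((G.verifier k).run P w t).support, c.workHead = z} ⊆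
      ((Finset.range (w.length + 2)).image (fun i : ℕ => (i : ℤ)) : Finset ℤ) := by
    rintro z ⟨t, c, hc, rfl⟩
    obtain ⟨h1, h2⟩ := G.heads_aligned P w t c hc
    rw [h1]
    simp only [Finset.coe_image, Set.mem_image, Finset.mem_coe, Finset.mem_range]
    exact ⟨c.inputHead, by omega, rfl⟩
  refine (Set.encard_le_encard hsub).trans ?_
  rw [Set.encard_coe_eq_coe_finsetCard]
  refine Nat.cast_le.2 (Finset.card_image_le.trans ?_)
  rw [Finset.card_range]
  omega

end Program

/-! ### Digits and indices of words -/

/-- The digit with weight `(m + 1) ^ i` of `x` in base `m + 1`. -/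
def digit (m i x : ℕ) : Fin (m + 1) :=
  Fin.ofNat (m + 1) (x / (m + 1) ^ i)

theorem digit_eq_digit_iff {m i x y : ℕ} :
    digit m i x = digit m i y ↔ x / (m + 1) ^ i % (m + 1) = y / (m + 1) ^ i % (m + 1) := by
  simp [digit, Fin.ext_iff]

/-- A carry reaches place `i` exactly when all lower digits of `x + 1` are 0, that is, when `(m + 1)
^ i` divides `x + 1`. This form lets the carry be read off the new digits. -/
theorem digit_succ (m i x : ℕ) :
    digit m i (x + 1) = if (m + 1) ^ i ∣ x + 1 then digit m i x + 1 else digit m i x := by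
  unfold digit
  rw [Nat.succ_div]
  split_ifs with h
  · simp [Fin.ext_iff, Fin.val_add]
  · simp

theorem pow_succ_dvd_iff_digit {m i x : ℕ} :
    (m + 1) ^ (i + 1) ∣ x ↔ (m + 1) ^ i ∣ x ∧ digit m i x = 0 := by
  have h0 : digit m i x = 0 ↔ x / (m + 1) ^ i % (m + 1) = 0 := by
    simp [digit, Fin.ext_iff]
  rw [h0, Nat.dvd_iff_mod_eq_zero, Nat.dvd_iff_mod_eq_zero, Nat.mod_pow_succ]
  simp

theorem mod_pow_succ_eq_iff_digit {m i x y : ℕ} :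
    x % (m + 1) ^ (i + 1) = y % (m + 1) ^ (i + 1) ↔
      x % (m + 1) ^ i = y % (m + 1) ^ i ∧ digit m i x = digit m i y := by
  rw [digit_eq_digit_iff, Nat.mod_pow_succ, Nat.mod_pow_succ]
  have hp : 0 < (m + 1) ^ i := by positivity
  have hx := Nat.mod_lt x hp
  have hy := Nat.mod_lt y hp
  constructor
  · intro h
    have h1 := congrArg (· % (m + 1) ^ i) h
    have h2 := congrArg (· / (m + 1) ^ i) h
    simp only [Nat.add_mul_mod_self_left, Nat.mod_mod] at h1
    simp only [Nat.add_mul_div_left _ _ hp, Nat.div_eq_of_lt hx, Nat.div_eq_of_lt hy,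
      zero_add] at h2
    exact ⟨h1, h2⟩
  · rintro ⟨h1, h2⟩
    rw [h1, h2]

theorem digit_of_lt {m i x : ℕ} (h : x < (m + 1) ^ i) : digit m i x = 0 := by
  simp [digit, Nat.div_eq_of_lt h]

theorem digit_zero (m i : ℕ) : digit m i 0 = 0 := digit_of_lt (by positivity)

theorem digit_add_mul_of_lt {m i l x d : ℕ} (h : l < i) :
    digit m l (x + (m + 1) ^ i * d) = digit m l x := by
  rw [digit_eq_digit_iff]
  obtain ⟨e, rfl⟩ := Nat.exists_eq_add_of_lt h
  have : x + (m + 1) ^ (l + e + 1) * d = x + (m + 1) ^ l * ((m + 1) * ((m + 1) ^ e * d)) := by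
    ring
  rw [this, Nat.add_mul_div_left _ _ (by positivity), Nat.add_mul_mod_self_left]

theorem digit_add_mul_self {m i x : ℕ} (hx : x < (m + 1) ^ i) (d : Fin (m + 1)) :
    digit m i (x + (m + 1) ^ i * d) = d := by
  rw [digit, Nat.add_mul_div_left _ _ (by positivity), Nat.div_eq_of_lt hx]
  simp

/-- The index of a word: its value as a numeral in base `k + 1`, least significant digit first, where
the letters stand for the nonzero digits. -/
def wordIndex {k : ℕ} : List (Fin k) → ℕ
  | [] => 0
  | a :: w => (a + 1) + (k + 1) * wordIndex w

theorem wordIndex_lt {k : ℕ} (w : List (Fin k)) : wordIndex w < (k + 1) ^ w.length := by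
  induction w with
  | nil => simp [wordIndex]
  | cons a w ih =>
    have := a.2
    rw [wordIndex, List.length_cons, pow_succ']
    calc (a + 1) + (k + 1) * wordIndex w < (k + 1) + (k + 1) * wordIndex w := by omega
      _ = (k + 1) * (wordIndex w + 1) := by ring
      _ ≤ _ := Nat.mul_le_mul_left _ ih

/-- Needed to compare `θ.gate ^ (wordIndex w + 1)` with the number `(k + 1) ^ w.length` of targets.
-/
theorem length_le_wordIndex {k : ℕ} (w : List (Fin k)) : w.length ≤ wordIndex w := by
  induction w with
  | nil => simp
  | cons a w ih =>
    rw [wordIndex, List.length_cons]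
    nlinarith [Nat.zero_le (k * wordIndex w)]

/-- The digit 0 stands for no letter, so words of different lengths cannot share a numeral. -/
theorem wordIndex_injective {k : ℕ} : Function.Injective (wordIndex (k := k)) := by
  intro v
  induction v with
  | nil =>
    intro w h
    cases w with
    | nil => rfl
    | cons a w => simp [wordIndex] at h; omega
  | cons a v ih =>
    intro w h
    cases w with
    | nil => simp [wordIndex] at h
    | cons a' w =>
      rw [wordIndex, wordIndex] at h
      have h1 := congrArg (· % (k + 1)) h
      simp only [Nat.add_mul_mod_self_left] at h1
      rw [Nat.mod_eq_of_lt (by have := a.2; omega), Nat.mod_eq_of_lt (by have := a'.2; omega)] at h1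
      have h2 : (k + 1) * wordIndex v = (k + 1) * wordIndex w := by omega
      rw [ih (Nat.eq_of_mul_eq_mul_left (by omega) h2), Fin.ext (by omega : a.val = a'.val)]

theorem digit_wordIndex {k : ℕ} (w : List (Fin k)) (i : ℕ) (hi : i < w.length) :
    digit k i (wordIndex w) = w[i].succ := by
  induction w generalizing i with
  | nil => simp at hi
  | cons a w ih =>
    cases i with
    | zero =>
      have := a.2
      simp [digit, wordIndex, Fin.ext_iff]
    | succ i =>
      have := a.2
      have h : digit k (i + 1) (wordIndex (a :: w)) = digit k i (wordIndex w) := by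
        rw [digit, digit, pow_succ', ← Nat.div_div_eq_div_mul, wordIndex,
          Nat.add_mul_div_left _ _ (by omega), Nat.div_eq_of_lt (by omega : a.val + 1 < k + 1),
          zero_add]
      rw [h, ih i (by simpa using hi)]
      rfl

/-! ### Halting probabilities of compiled programs -/

namespace Program

variable (G : Program) {k : ℕ}

/-- The work tape with the pairs `f 0, f 1, …` in the cells `1, 2, …`. -/
def tapeOf (f : ℕ → DigitPair k) : ℤ → Option (DigitPair k) :=
  fun z => if 0 < z then (f (z - 1).toNat).encode else none

theorem tapeOf_succ (f : ℕ → DigitPair k) (i : ℕ) : tapeOf f ((i + 1 : ℕ) : ℤ) = (f i).encode := by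
  have h : (0 : ℤ) < ((i + 1 : ℕ) : ℤ) := by positivity
  rw [tapeOf, if_pos h]
  simp

theorem update_tapeOf (f : ℕ → DigitPair k) (i : ℕ) (c : DigitPair k) :
    Function.update (tapeOf f) ((i + 1 : ℕ) : ℤ) c.encode = tapeOf (Function.update f i c) := by
  funext z
  by_cases hz : z = ((i + 1 : ℕ) : ℤ)
  · subst hz
    rw [Function.update_self, tapeOf_succ, Function.update_self]
  · rw [Function.update_of_ne hz, tapeOf, tapeOf]
    split_ifs with h0
    · rw [Function.update_of_ne]
      omega
    · rfl

/-- The configuration with given components. -/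
def mkConfig (s : VerifierState (Stage G.Q) G.Q) (i : ℕ) (tp : ℤ → Option (DigitPair k)) (z : ℤ)
    (m : List G.Υ) : (G.verifier k).Config where
  state := s
  inputHead := i
  tape := tp
  workHead := z
  sent := m

/-- The configuration with both heads on the cell `i`. -/
def configAt (s : VerifierState (Stage G.Q) G.Q) (i : ℕ) (f : ℕ → DigitPair k)
    (m : List G.Υ) : (G.verifier k).Config :=
  G.mkConfig s i (tapeOf f) i m

/-- The configuration that results from a transition with both heads on the cell `i`. -/
def outcome (n i : ℕ) (f : ℕ → DigitPair k) (m : List G.Υ)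
    (o : VerifierState (Stage G.Q) G.Q × Option (DigitPair k) × HeadMove × HeadMove) :
    (G.verifier k).Config :=
  G.mkConfig o.1 (moveInputHead n i o.2.2.1) (Function.update (tapeOf f) (i : ℤ) o.2.1)
    (moveWorkHead i o.2.2.2) m

theorem outcome_stay (n i : ℕ) (f : ℕ → DigitPair k) (m : List G.Υ)
    (s : VerifierState (Stage G.Q) G.Q) :
    G.outcome n i f m (s, tapeOf f i, .stay, .stay) = G.configAt s i f m := by
  simp [outcome, configAt, moveInputHead, moveWorkHead]

theorem outcome_left (n i : ℕ) (f : ℕ → DigitPair k) (m : List G.Υ)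
    (s : VerifierState (Stage G.Q) G.Q) :
    G.outcome n (i + 1) f m (s, tapeOf f (i + 1 : ℕ), .left, .left) = G.configAt s i f m := by
  rw [outcome, Function.update_eq_self]
  simp [configAt, moveInputHead, moveWorkHead]

theorem outcome_right {n i : ℕ} (hi : i ≤ n) (f : ℕ → DigitPair k) (m : List G.Υ)
    (s : VerifierState (Stage G.Q) G.Q) :
    G.outcome n i f m (s, tapeOf f i, .right, .right) = G.configAt s (i + 1) f m := by
  simp [outcome, configAt, moveInputHead, moveWorkHead, hi]

theorem outcome_write_left (n i : ℕ) (f : ℕ → DigitPair k) (m : List G.Υ)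
    (s : VerifierState (Stage G.Q) G.Q) (c : DigitPair k) :
    G.outcome n (i + 1) f m (s, c.encode, .left, .left) =
      G.configAt s i (Function.update f i c) m := by
  rw [outcome, update_tapeOf]
  simp [configAt, moveInputHead, moveWorkHead]

theorem outcome_write_right {n i : ℕ} (hi : i < n) (f : ℕ → DigitPair k) (m : List G.Υ)
    (s : VerifierState (Stage G.Q) G.Q) (c : DigitPair k) :
    G.outcome n (i + 1) f m (s, c.encode, .right, .right) =
      G.configAt s (i + 1 + 1) (Function.update f i c) m := by
  rw [outcome, update_tapeOf]
  simp [configAt, moveInputHead, moveWorkHead, Nat.succ_le_of_lt hi]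

/-- The digits of a position and of a target. -/
def digitPairs (k x y : ℕ) : ℕ → DigitPair k :=
  fun i => (digit k i x, digit k i y)

variable (P : (G.verifier k).Prover) (w : List (Fin k)) {h : VerifierState (Stage G.Q) G.Q}

/-- The probability of eventually being in the halting state `h` when `G` is in the state `q`, with
position `x`, target `y` and sent symbols `m`. -/
noncomputable def value (h : VerifierState (Stage G.Q) G.Q) (q : G.Q) (x y : ℕ)
    (m : List G.Υ) : ℝ :=
  (G.verifier k).value P w h (G.configAt (G.enter q) 0 (digitPairs k x y) m)

theorem value_nonneg (q : G.Q) (x y : ℕ) (m : List G.Υ) : 0 ≤ G.value P w h q x y m :=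
  (G.verifier k).value_nonneg P w h _

theorem value_le_one (q : G.Q) (x y : ℕ) (m : List G.Υ) : G.value P w h q x y m ≤ 1 :=
  (G.verifier k).value_le_one P w h _

theorem value_accept {q : G.Q} (hq : G.instr q = .accept) (x y : ℕ) (m : List G.Υ) :
    G.value P w .accept q x y m = 1 :=
  (G.verifier k).value_of_state_eq P w (by simp only [configAt, mkConfig, enter, hq]; rfl)

theorem value_reject {q : G.Q} (hq : G.instr q = .reject) (x y : ℕ) (m : List G.Υ) :
    G.value P w .reject q x y m = 1 :=
  (G.verifier k).value_of_state_eq P w (by simp only [configAt, mkConfig, enter, hq]; rfl)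

theorem inputSymbolAt_succ {A : Type} {w : List A} {i : ℕ} (hi : i < w.length) :
    inputSymbolAt w (i + 1) = .letter w[i] := by
  simp [inputSymbolAt, hi]

theorem inputSymbolAt_length_succ {A : Type} (w : List A) :
    inputSymbolAt w (w.length + 1) = .rightEnd := by
  simp [inputSymbolAt]

theorem value_talk (hh : h.IsHalting) {q : G.Q} {s : G.Υ} {next : G.Υ → G.Q}
    (hq : G.instr q = .talk s next) (x y : ℕ) (m : List G.Υ) :
    G.value P w h q x y m = G.value P w h (next (P w (s :: m))) x y (s :: m) := by
  refine (G.verifier k).value_of_step_eq_pure P w hh ?_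
  simp [PTMVerifier.step, configAt, mkConfig, enter, hq, verifier]

theorem step_configAt_reading (r : Stage G.Q) (i : ℕ) (f : ℕ → DigitPair k) (m : List G.Υ) :
    (G.verifier k).step P w (G.configAt (.reading r) i f m) =
      (G.readTrans r (inputSymbolAt w i) (tapeOf f i)).map
        (G.outcome w.length i f m) := rfl

theorem value_toss (hh : h.IsHalting) {q : G.Q} {p : unitInterval} {next : Bool → G.Q}
    (hq : G.instr q = .toss p next) (x y : ℕ) (m : List G.Υ) :
    G.value P w h q x y m =
      p * G.value P w h (next true) x y m + (1 - p) * G.value P w h (next false) x y m := by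
  have he : G.enter q = .reading (.home q) := by simp [enter, hq]
  have := (G.verifier k).value_of_step_eq_map P w hh
    (c := G.configAt (G.enter q) 0 (digitPairs k x y) m) (coin p)
    (fun b => G.configAt (G.enter (next b)) 0 (digitPairs k x y) m) (by
      rw [he, step_configAt_reading]
      simp only [inputSymbolAt, readTrans, hq, PMF.map_comp]
      congr 1
      funext b
      exact G.outcome_stay _ _ _ _ _)
  rw [value, this, Fintype.sum_bool, coin_toReal, coin_toReal]
  rfl

theorem value_back (hh : h.IsHalting) (q : G.Q) (c : Bool) (m : List G.Υ) (i : ℕ)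
    (hi : i ≤ w.length) (f : ℕ → DigitPair k) :
    (G.verifier k).value P w h (G.configAt (.reading (.back q c)) i f m) =
      (G.verifier k).value P w h (G.configAt (G.enter q) 0
        (fun l => if c ∧ l < i then (0, (f l).2) else f l) m) := by
  induction i generalizing f with
  | zero =>
    refine (G.verifier k).value_of_step_eq_pure P w hh ?_
    rw [step_configAt_reading]
    simp only [inputSymbolAt, readTrans, PMF.pure_map, outcome_stay]
    simp
  | succ i ih =>
    have hs : (G.verifier k).step P w (G.configAt (.reading (.back q c)) (i + 1) f m) =
        PMF.pure (G.configAt (.reading (.back q c)) i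
          (if c then Function.update f i (0, (f i).2) else f) m) := by
      rw [step_configAt_reading, inputSymbolAt_succ hi]
      cases c
      · simp only [readTrans, PMF.pure_map, Bool.false_eq_true, if_false, outcome_left]
      · rw [tapeOf_succ]
        simp [readTrans, PMF.pure_map, outcome_write_left]
    rw [(G.verifier k).value_of_step_eq_pure P w hh hs, ih (by omega)]
    congr 2
    funext l
    cases c
    · simp
    · by_cases hl : l = i
      · subst hl; simp
      · have : l < i + 1 ↔ l < i := by omega
        simp [Function.update_of_ne hl, this]

/-- Invariant of the increment sweep after `i` cells: the carry is a divisibility, the two flags are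
congruences modulo `(k + 1) ^ i`, and the first `i` position digits are already those of `x + 1`. -/
theorem value_incr (hh : h.IsHalting) (next : Bool → Bool → G.Q) (x y : ℕ) (m : List G.Υ) (i : ℕ)
    (hi : i ≤ w.length) :
    (G.verifier k).value P w h (G.configAt (.reading (.incr next true true true)) 1
        (digitPairs k x y) m) =
      (G.verifier k).value P w h (G.configAt (.reading (.incr next
          (decide ((k + 1) ^ i ∣ x + 1)) (decide (x % (k + 1) ^ i = y % (k + 1) ^ i))
          (decide (x % (k + 1) ^ i = wordIndex w % (k + 1) ^ i)))) (i + 1)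
        (fun l => if l < i then digitPairs k (x + 1) y l else digitPairs k x y l) m) := by
  induction i with
  | zero => simp [Nat.mod_one]
  | succ i ih =>
    rw [ih (by omega)]
    refine (G.verifier k).value_of_step_eq_pure P w hh ?_
    rw [step_configAt_reading, inputSymbolAt_succ hi, tapeOf_succ]
    have hd : digit k i (x + 1) = if decide ((k + 1) ^ i ∣ x + 1) = true then digit k i x + 1
        else digit k i x := by simp [digit_succ]
    simp only [readTrans, PMF.pure_map, DigitPair.decode_encode, lt_irrefl, if_false, digitPairs,
      ← hd, G.outcome_write_right hi]
    have h1 : decide ((k + 1) ^ (i + 1) ∣ x + 1) =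
        (decide ((k + 1) ^ i ∣ x + 1) && decide (digit k i (x + 1) = 0)) := by
      simp [pow_succ_dvd_iff_digit]
    have h2 : ∀ z, decide (x % (k + 1) ^ (i + 1) = z % (k + 1) ^ (i + 1)) =
        (decide (x % (k + 1) ^ i = z % (k + 1) ^ i) && decide (digit k i x = digit k i z)) := by
      intro z
      simp [mod_pow_succ_eq_iff_digit]
    rw [h1, h2, h2, digit_wordIndex w i hi]
    congr 1
    have hf : Function.update
        (fun l => if l < i then (digit k l (x + 1), digit k l y) else (digit k l x, digit k l y)) i
        (digit k i (x + 1), digit k i y) =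
        fun l => if l < i + 1 then (digit k l (x + 1), digit k l y)
          else (digit k l x, digit k l y) := by
      funext l
      by_cases hl : l = i
      · subst hl; simp
      · have : l < i + 1 ↔ l < i := by omega
        simp [Function.update_of_ne hl, this]
    rw [hf]

/-- The bounds on `x` and `y` keep all nonzero digits within the cells of the word, so the
congruences at the end of the sweep are equalities. The reset takes place on the way back. -/
theorem value_tick (hh : h.IsHalting) {q : G.Q} {next : Bool → Bool → G.Q}
    (hq : G.instr q = .tick next) {x y : ℕ} (hx : x ≤ wordIndex w)
    (hy : y < (k + 1) ^ w.length) (m : List G.Υ) :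
    G.value P w h q x y m =
      G.value P w h (next (decide (x = y)) (decide (x = wordIndex w)))
        (if x = wordIndex w then 0 else x + 1) y m := by
  have he : G.enter q = .reading (.home q) := by simp [enter, hq]
  have hw := wordIndex_lt w
  have hxw : x < (k + 1) ^ w.length := by omega
  have hs : (G.verifier k).step P w (G.configAt (G.enter q) 0 (digitPairs k x y) m) =
      PMF.pure (G.configAt (.reading (.incr next true true true)) 1 (digitPairs k x y) m) := by
    rw [he, step_configAt_reading]
    simp only [inputSymbolAt, readTrans, hq, PMF.pure_map, G.outcome_right (Nat.zero_le _)]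
  rw [value, (G.verifier k).value_of_step_eq_pure P w hh hs,
    G.value_incr P w hh next x y m w.length le_rfl]
  simp only [Nat.mod_eq_of_lt hxw, Nat.mod_eq_of_lt hy, Nat.mod_eq_of_lt hw]
  set f : ℕ → DigitPair k := fun l =>
    if l < w.length then digitPairs k (x + 1) y l else digitPairs k x y l with hf
  have hs2 : ∀ c e g, (G.verifier k).step P w
      (G.configAt (.reading (.incr next c e g)) (w.length + 1) f m) =
      PMF.pure (G.configAt (.reading (.back (next e g) g)) w.length f m) := by
    intro c e g
    rw [step_configAt_reading, inputSymbolAt_length_succ]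
    simp only [readTrans, PMF.pure_map, outcome_left]
  rw [(G.verifier k).value_of_step_eq_pure P w hh (hs2 _ _ _), G.value_back P w hh _ _ _ _ le_rfl,
    value]
  congr 2
  funext l
  by_cases hxe : x = wordIndex w
  · by_cases hl : l < w.length
    · simp [hxe, hl, hf, digitPairs, digit_zero]
    · have : x < (k + 1) ^ l := hxw.trans_le (Nat.pow_le_pow_right (by omega) (by omega))
      simp [hf, hl, digitPairs, digit_zero, hxe]
      exact digit_of_lt (hxe ▸ this)
  · by_cases hl : l < w.length
    · simp [hxe, hl, hf]
    · have : x + 1 < (k + 1) ^ l :=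
        lt_of_lt_of_le (by omega) (Nat.pow_le_pow_right (by omega) (not_lt.1 hl))
      simp [hf, hl, digitPairs, hxe, digit_of_lt this, digit_of_lt (Nat.lt_of_succ_lt this)]

theorem sum_range_mul_eq {M : Type*} [AddCommMonoid M] (m n : ℕ) (f : ℕ → M) :
    ∑ u ∈ Finset.range (m * n), f u =
      ∑ d : Fin m, ∑ u ∈ Finset.range n, f (d + m * u) := by
  rw [Finset.sum_comm, mul_comm, Finset.sum_range, ← finProdFinEquiv.sum_comp, Fintype.sum_prod_type,
    Finset.sum_range]
  simp [finProdFinEquiv]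

/-- Here `y` collects the digits drawn so far and `z` is the old target, still present in the
remaining cells. Drawing the digits independently averages over all continuations `y + (k + 1) ^ i *
u`. -/
theorem value_draw (hh : h.IsHalting) (q : G.Q) (x : ℕ) (m : List G.Υ) (n i : ℕ)
    (hi : i + n = w.length) (y z : ℕ) (hy : y < (k + 1) ^ i) (hz : z < (k + 1) ^ w.length) :
    (G.verifier k).value P w h (G.configAt (.reading (.draw q)) (i + 1)
        (fun l => if l < i then digitPairs k x y l else digitPairs k x z l) m) =
      (∑ u ∈ Finset.range ((k + 1) ^ n), G.value P w h q x (y + (k + 1) ^ i * u) m) /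
        ((k + 1) ^ n : ℕ) := by
  induction n generalizing i y with
  | zero =>
    obtain rfl : i = w.length := by omega
    set f : ℕ → DigitPair k := fun l =>
      if l < w.length then digitPairs k x y l else digitPairs k x z l with hf
    have hs : (G.verifier k).step P w (G.configAt (.reading (.draw q)) (w.length + 1) f m) =
        PMF.pure (G.configAt (.reading (.back q false)) w.length f m) := by
      rw [step_configAt_reading, inputSymbolAt_length_succ]
      simp only [readTrans, PMF.pure_map, outcome_left]
    rw [(G.verifier k).value_of_step_eq_pure P w hh hs, G.value_back P w hh _ _ _ _ le_rfl]
    have hfe : f = digitPairs k x y := by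
      funext l
      by_cases hl : l < w.length
      · simp [hf, hl]
      · have hp : (k + 1) ^ w.length ≤ (k + 1) ^ l := Nat.pow_le_pow_right (by omega) (not_lt.1 hl)
        simp [hf, hl, digitPairs, digit_of_lt (hz.trans_le hp), digit_of_lt (hy.trans_le hp)]
    simp [value, hfe]
  | succ n ih =>
    have hi' : i < w.length := by omega
    set f : ℕ → DigitPair k := fun l =>
      if l < i then digitPairs k x y l else digitPairs k x z l with hf
    have := (G.verifier k).value_of_step_eq_map P w hh
      (c := G.configAt (.reading (.draw q)) (i + 1) f m) (PMF.uniformOfFintype (Fin (k + 1)))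
      (fun d => G.configAt (.reading (.draw q)) (i + 1 + 1) (fun l => if l < i + 1 then
        digitPairs k x (y + (k + 1) ^ i * d) l else digitPairs k x z l) m) (by
        rw [step_configAt_reading, inputSymbolAt_succ hi', tapeOf_succ]
        simp only [readTrans, PMF.map_comp]
        congr 1
        funext d
        simp only [Function.comp_apply, DigitPair.decode_encode, G.outcome_write_right hi']
        have hfe : Function.update f i ((f i).1, d) = fun l => if l < i + 1 then
            digitPairs k x (y + (k + 1) ^ i * d) l else digitPairs k x z l := by
          funext l
          by_cases hl : l = i
          · subst hl
            simp [hf, digitPairs, digit_add_mul_self hy]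
          · rcases lt_or_gt_of_ne hl with h1 | h1
            · simp [hf, hl, h1, digitPairs, digit_add_mul_of_lt, h1.trans (Nat.lt_succ_self i)]
            · have h2 : ¬ l < i := by omega
              have h3 : ¬ l < i + 1 := by omega
              simp [hf, hl, h2, h3]
        rw [hfe])
    rw [this]
    have hd : ∀ d : Fin (k + 1), (G.verifier k).value P w h (G.configAt (.reading (.draw q))
        (i + 1 + 1) (fun l => if l < i + 1 then
        digitPairs k x (y + (k + 1) ^ i * d) l else digitPairs k x z l) m) =
        (∑ u ∈ Finset.range ((k + 1) ^ n),
          G.value P w h q x (y + (k + 1) ^ i * (d + (k + 1) * u)) m) / ((k + 1) ^ n : ℕ) := by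
      intro d
      rw [ih (i + 1) (by omega) _ (by
        calc y + (k + 1) ^ i * d < (k + 1) ^ i + (k + 1) ^ i * d := by omega
          _ = (k + 1) ^ i * (d + 1) := by ring
          _ ≤ (k + 1) ^ i * (k + 1) := Nat.mul_le_mul_left _ d.2
          _ = _ := (pow_succ _ _).symm)]
      congr 1
      refine Finset.sum_congr rfl fun u _ => ?_
      congr 1
      ring
    simp_rw [hd, PMF.uniformOfFintype_apply]
    rw [← Finset.mul_sum, ← Finset.sum_div,
      ← sum_range_mul_eq (k + 1) ((k + 1) ^ n)
        (fun u => G.value P w h q x (y + (k + 1) ^ i * u) m), ← pow_succ']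
    rw [Fintype.card_fin, ENNReal.toReal_inv, ENNReal.toReal_natCast]
    rw [pow_succ' (k + 1) n]
    push_cast
    field_simp

theorem value_pick (hh : h.IsHalting) {q next : G.Q} (hq : G.instr q = .pick next) (x : ℕ) {y : ℕ}
    (hy : y < (k + 1) ^ w.length) (m : List G.Υ) :
    G.value P w h q x y m =
      (∑ u ∈ Finset.range ((k + 1) ^ w.length), G.value P w h next x u m) /
        ((k + 1) ^ w.length : ℕ) := by
  have he : G.enter q = .reading (.home q) := by simp [enter, hq]
  have hs : (G.verifier k).step P w (G.configAt (G.enter q) 0 (digitPairs k x y) m) =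
      PMF.pure (G.configAt (.reading (.draw next)) 1 (digitPairs k x y) m) := by
    rw [he, step_configAt_reading]
    simp only [inputSymbolAt, readTrans, hq, PMF.pure_map, G.outcome_right (Nat.zero_le _)]
  rw [value, (G.verifier k).value_of_step_eq_pure P w hh hs]
  have := G.value_draw P w hh next x m w.length 0 (by omega) 0 y (by simp) hy
  simpa using this

theorem value_startConfig (hh : h.IsHalting) :
    (G.verifier k).value P w h (G.verifier k).startConfig = G.value P w h G.start 0 0 [] := by
  have hc : (G.verifier k).startConfig =
      G.configAt (.reading (.back G.start false)) 0 (digitPairs k 0 0) [] := by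
    have : tapeOf (digitPairs k 0 0) = fun _ => none := by
      funext z
      simp [tapeOf, digitPairs, digit_zero, DigitPair.encode]
    simp only [configAt, this]
    rfl
  rw [hc, G.value_back P w hh _ _ _ _ (Nat.zero_le _)]
  simp [value]

end Program

/-! ### The protocol -/

/-- The communication alphabet of the protocol. -/
inductive ProtocolSymbol (m : ℕ) where
  | reset
  | announce (a : Bool)
  | query
  | digits (d : Fin (m + 1) × Fin (m + 1))

namespace ProtocolSymbol

instance (m : ℕ) : Finite (ProtocolSymbol m) := by
  let f : Bool ⊕ Bool ⊕ (Fin (m + 1) × Fin (m + 1)) → ProtocolSymbol m := fun x =>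
    match x with
    | .inl b => cond b .reset .query
    | .inr (.inl a) => .announce a
    | .inr (.inr d) => .digits d
  refine Finite.of_surjective f fun s => ?_
  cases s with
  | reset => exact ⟨.inl true, rfl⟩
  | query => exact ⟨.inl false, rfl⟩
  | announce a => exact ⟨.inr (.inl a), rfl⟩
  | digits d => exact ⟨.inr (.inr d), rfl⟩

/-- The digits that a reply stands for. -/
def toDigits {m : ℕ} : ProtocolSymbol m → Fin (m + 1) × Fin (m + 1)
  | .digits d => d
  | _ => (0, 0)

end ProtocolSymbol

/-- What the verifier remembers while the prover dictates the number of tosses and the number of heads,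
least significant digits first: the last known digits at the target position of each of the
seven phases, the current phase, whether there is a carry to the next digit of each number, and
whether the decisive digit of the number of heads was `2`. -/
structure Scan (m : ℕ) where
  stored : Fin 7 → Fin (m + 1) × Fin (m + 1)
  phase : Fin 7
  carryTosses : Bool
  carryHeads : Bool
  claim : Bool

namespace Scan

variable {m : ℕ}

instance : Finite (Scan m) := by
  let f : (Fin 7 → Fin (m + 1) × Fin (m + 1)) × Fin 7 × Bool × Bool × Bool → Scan m :=
    fun x => ⟨x.1, x.2.1, x.2.2.1, x.2.2.2.1, x.2.2.2.2⟩
  exact Finite.of_surjective f fun c =>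
    ⟨(c.stored, c.phase, c.carryTosses, c.carryHeads, c.claim), rfl⟩

/-- The digits that the prover should dictate at the target position. -/
def expected (c : Scan m) : Fin (m + 1) × Fin (m + 1) :=
  (if c.carryTosses then (c.stored c.phase).1 + 1 else (c.stored c.phase).1,
    if c.carryHeads then (c.stored c.phase).2 + 1 else (c.stored c.phase).2)

/-- The update after a pair of digits. -/
def next (c : Scan m) (d : Fin (m + 1) × Fin (m + 1)) (onTarget last : Bool) : Scan m where
  stored := if onTarget then Function.update c.stored c.phase d else c.stored
  phase := if last then c.phase + 1 else c.phase
  carryTosses := c.carryTosses && decide (d.1 = 0)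
  carryHeads := c.carryHeads && decide (d.2 = 0)
  -- Phases count from 0, so the end of phase 5 is place `6 * M - 1`, for phases of length `M`. The
  -- decisive digit is put at the end of a phase so that it can be recognized without another
  -- counter.
  claim := if last ∧ c.phase = 5 then decide (d.2 = 2) else c.claim

end Scan

/-- The states of the protocol. -/
inductive ProtocolState (m : ℕ) where
  | reset
  | pick
  | clock (st : Fin 7 → Fin (m + 1) × Fin (m + 1)) (all : Bool)
  | clockTick (st : Fin 7 → Fin (m + 1) × Fin (m + 1)) (all : Bool)
  | flip (st : Fin 7 → Fin (m + 1) × Fin (m + 1))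
  | announce (st : Fin 7 → Fin (m + 1) × Fin (m + 1)) (a : Bool)
  | query (c : Scan m)
  | got (c : Scan m) (d : Fin (m + 1) × Fin (m + 1))
  | gate (all : Bool)
  | gateTick (all : Bool)
  | accept
  | reject

namespace ProtocolState

instance (m : ℕ) : Finite (ProtocolState m) := by
  let S := Fin 7 → Fin (m + 1) × Fin (m + 1)
  let f : Fin 4 ⊕ (S × Bool) ⊕ (S × Bool) ⊕ S ⊕ (S × Bool) ⊕ Scan m ⊕
      (Scan m × Fin (m + 1) × Fin (m + 1)) ⊕ Bool ⊕ Bool → ProtocolState m := fun x =>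
    match x with
    | .inl 0 => .reset
    | .inl 1 => .pick
    | .inl 2 => .accept
    | .inl 3 => .reject
    | .inr (.inl (s, a)) => .clock s a
    | .inr (.inr (.inl (s, a))) => .clockTick s a
    | .inr (.inr (.inr (.inl s))) => .flip s
    | .inr (.inr (.inr (.inr (.inl (s, a))))) => .announce s a
    | .inr (.inr (.inr (.inr (.inr (.inl c))))) => .query c
    | .inr (.inr (.inr (.inr (.inr (.inr (.inl (c, d))))))) => .got c d
    | .inr (.inr (.inr (.inr (.inr (.inr (.inr (.inl a))))))) => .gate a
    | .inr (.inr (.inr (.inr (.inr (.inr (.inr (.inr a))))))) => .gateTick a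
  refine Finite.of_surjective f fun s => ?_
  cases s with
  | reset => exact ⟨.inl 0, rfl⟩
  | pick => exact ⟨.inl 1, rfl⟩
  | accept => exact ⟨.inl 2, rfl⟩
  | reject => exact ⟨.inl 3, rfl⟩
  | clock s a => exact ⟨.inr (.inl (s, a)), rfl⟩
  | clockTick s a => exact ⟨.inr (.inr (.inl (s, a))), rfl⟩
  | flip s => exact ⟨.inr (.inr (.inr (.inl s))), rfl⟩
  | announce s a => exact ⟨.inr (.inr (.inr (.inr (.inl (s, a))))), rfl⟩
  | query c => exact ⟨.inr (.inr (.inr (.inr (.inr (.inl c))))), rfl⟩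
  | got c d => exact ⟨.inr (.inr (.inr (.inr (.inr (.inr (.inl (c, d))))))), rfl⟩
  | gate a => exact ⟨.inr (.inr (.inr (.inr (.inr (.inr (.inr (.inl a))))))), rfl⟩
  | gateTick a => exact ⟨.inr (.inr (.inr (.inr (.inr (.inr (.inr (.inr a))))))), rfl⟩

end ProtocolState

/-- The biases of the coins of the protocol: for the tosses to be counted, for giving up, and for
accepting after a successful repetition. -/
structure ProtocolCoins where
  heads : unitInterval
  clock : unitInterval
  gate : unitInterval

/-- The state after the digits `d` were dictated. -/
def Scan.continue {m : ℕ} (c : Scan m) (d : Fin (m + 1) × Fin (m + 1)) (onTarget last : Bool) :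
    ProtocolState m :=
  if onTarget ∧ d ≠ c.expected then .reject
  else if last ∧ c.phase = 6 then
    -- A carry out of the top place: the dictated toss counter has wrapped around to 0.
    if (c.next d onTarget last).carryTosses then
      if (c.next d onTarget last).claim then .gate true else .reject
    else .clock (c.next d onTarget last).stored true
  else .query (c.next d onTarget last)

/-- The protocol. In each repetition the verifier announces coin tosses, after each of which the prover
dictates the digits in base `m + 1` of the number of tosses and of the number of heads. The
verifier checks the increments at a random secret position. When the number of tosses wraps around,
a digit of the number of heads decides whether the repetition was successful. -/
noncomputable abbrev protocol (m : ℕ) (θ : ProtocolCoins) : Program where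
  Q := ProtocolState m
  Υ := ProtocolSymbol m
  finite_Q := inferInstance
  finite_Υ := inferInstance
  nonempty_Υ := ⟨.reset⟩
  start := .reset
  instr
    | .reset => .talk .reset fun _ => .pick
    -- Both counters restart at 0, so zeros are the correct stored digits whatever the target is.
    | .pick => .pick (.clock (fun _ => (0, 0)) true)
    | .clock st all => .toss θ.clock fun b => .clockTick st (all && b)
    | .clockTick st all => .tick fun _ last =>
        if last then if all then .reject else .flip st else .clock st all
    | .flip st => .toss θ.heads fun b => .announce st b
    -- The toss counter always receives an initial carry, the head counter only after heads.
    | .announce st a => .talk (.announce a) fun _ => .query ⟨st, 0, true, a, false⟩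
    | .query c => .talk .query fun s => .got c s.toDigits
    | .got c d => .tick fun onTarget last => c.continue d onTarget last
    | .gate all => .toss θ.gate fun b => .gateTick (all && b)
    | .gateTick all => .tick fun _ last =>
        if last then if all then .accept else .reset else .gate all
    | .accept => .accept
    | .reject => .reject

/-- A finite control and a counter up to `N` realize an event of probability `p ^ (N + 1)`: toss
once per position and remember whether all tosses succeeded. With `N = wordIndex w` this produces
probabilities that are doubly exponentially small in `|w|`, as the clock and the gate require. -/
theorem repeated_toss_value {N : ℕ} {f t : Bool → ℕ → ℝ} {p U W : ℝ}
    (hf : ∀ all x, x ≤ N → f all x = p * t all x + (1 - p) * t false x)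
    (ht : ∀ all x, x < N → t all x = f all (x + 1)) (hU : t true N = U) (hW : t false N = W) :
    f true 0 = p ^ (N + 1) * U + (1 - p ^ (N + 1)) * W := by
  have h1 : ∀ n x, x + n = N → f false x = W := by
    intro n
    induction n with
    | zero =>
      intro x hx
      obtain rfl : x = N := hx
      rw [hf _ _ le_rfl, hW]; ring
    | succ n ih =>
      intro x hx
      rw [hf _ _ (by omega), ht _ _ (by omega), ih (x + 1) (by omega)]; ring
  have h2 : ∀ n x, x + n = N → f true x = p ^ (n + 1) * U + (1 - p ^ (n + 1)) * W := by
    intro n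
    induction n with
    | zero =>
      intro x hx
      obtain rfl : x = N := hx
      rw [hf _ _ le_rfl, hW, hU]; ring
    | succ n ih =>
      intro x hx
      rw [hf _ _ (by omega), ht _ _ (by omega), ih (x + 1) (by omega), ht _ _ (by omega),
        h1 n (x + 1) (by omega)]
      ring
  exact h2 N 0 (by omega)

namespace Protocol

variable {m k : ℕ} (θ : ProtocolCoins) (P : List (Fin k) → List (ProtocolSymbol m) → ProtocolSymbol m)
  (w : List (Fin k))
  (h : VerifierState (Stage (ProtocolState m)) (ProtocolState m))

/-- The probability of eventually being in the halting state `h`. -/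
noncomputable def val (q : ProtocolState m) (x j : ℕ) (s : List (ProtocolSymbol m)) : ℝ :=
  (protocol m θ).value (k := k) P w h q x j s

theorem val_nonneg (q : ProtocolState m) (x j : ℕ) (s : List (ProtocolSymbol m)) :
    0 ≤ val θ P w h q x j s :=
  (protocol m θ).value_nonneg (k := k) P w q x j s

theorem val_le_one (q : ProtocolState m) (x j : ℕ) (s : List (ProtocolSymbol m)) :
    val θ P w h q x j s ≤ 1 :=
  (protocol m θ).value_le_one (k := k) P w q x j s

theorem val_accept (x j : ℕ) (s : List (ProtocolSymbol m)) :
    val θ P w .accept .accept x j s = 1 :=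
  (protocol m θ).value_accept (k := k) P w rfl x j s

theorem val_reject (x j : ℕ) (s : List (ProtocolSymbol m)) :
    val θ P w .reject .reject x j s = 1 :=
  (protocol m θ).value_reject (k := k) P w rfl x j s

variable {h} (hh : h.IsHalting)
include hh

theorem val_reset {j : ℕ} (hj : j < (k + 1) ^ w.length) (s : List (ProtocolSymbol m)) :
    val θ P w h .reset 0 j s =
      (∑ u ∈ Finset.range ((k + 1) ^ w.length),
        val θ P w h (.clock (fun _ => (0, 0)) true) 0 u (.reset :: s)) /
        ((k + 1) ^ w.length : ℕ) := by
  have h1 := (protocol m θ).value_talk (k := k) P w hh (q := .reset) rfl 0 j s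
  have h2 := (protocol m θ).value_pick (k := k) P w hh (q := .pick) rfl 0 hj (.reset :: s)
  exact h1.trans h2

theorem val_clock (st : Fin 7 → Fin (m + 1) × Fin (m + 1)) {j : ℕ}
    (hj : j < (k + 1) ^ w.length) (s : List (ProtocolSymbol m)) :
    val θ P w h (.clock st true) 0 j s =
      θ.clock ^ (wordIndex w + 1) * val θ P w h .reject 0 j s +
        (1 - θ.clock ^ (wordIndex w + 1)) * val θ P w h (.flip st) 0 j s := by
  have ht : ∀ all x, x ≤ wordIndex w → val θ P w h (.clockTick st all) x j s =
      val θ P w h (if x = wordIndex w then if all then .reject else .flip st else .clock st all)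
        (if x = wordIndex w then 0 else x + 1) j s := by
    intro all x hx
    have := (protocol m θ).value_tick (k := k) P w hh (q := .clockTick st all) rfl hx hj s
    simp only [decide_eq_true_eq] at this
    exact this
  refine repeated_toss_value (f := fun all x => val θ P w h (.clock st all) x j s)
    (t := fun all x => val θ P w h (.clockTick st all) x j s) ?_ ?_ ?_ ?_
  · intro all x _
    have := (protocol m θ).value_toss (k := k) P w hh (q := .clock st all) rfl x j s
    simp only [Bool.and_true, Bool.and_false] at this
    exact this
  · intro all x hx
    simp only [ht all x hx.le, if_neg hx.ne]
  · simp only [ht _ _ le_rfl, if_true]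
  · simp only [ht _ _ le_rfl, if_true, Bool.false_eq_true, if_false]

theorem val_gate {j : ℕ} (hj : j < (k + 1) ^ w.length) (s : List (ProtocolSymbol m)) :
    val θ P w h (.gate true) 0 j s =
      θ.gate ^ (wordIndex w + 1) * val θ P w h .accept 0 j s +
        (1 - θ.gate ^ (wordIndex w + 1)) * val θ P w h .reset 0 j s := by
  have ht : ∀ all x, x ≤ wordIndex w → val θ P w h (.gateTick all) x j s =
      val θ P w h (if x = wordIndex w then if all then .accept else .reset else .gate all)
        (if x = wordIndex w then 0 else x + 1) j s := by
    intro all x hx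
    have := (protocol m θ).value_tick (k := k) P w hh (q := .gateTick all) rfl hx hj s
    simp only [decide_eq_true_eq] at this
    exact this
  refine repeated_toss_value (f := fun all x => val θ P w h (.gate all) x j s)
    (t := fun all x => val θ P w h (.gateTick all) x j s) ?_ ?_ ?_ ?_
  · intro all x _
    have := (protocol m θ).value_toss (k := k) P w hh (q := .gate all) rfl x j s
    simp only [Bool.and_true, Bool.and_false] at this
    exact this
  · intro all x hx
    simp only [ht all x hx.le, if_neg hx.ne]
  · simp only [ht _ _ le_rfl, if_true]
  · simp only [ht _ _ le_rfl, if_true, Bool.false_eq_true, if_false]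

theorem val_flip (st : Fin 7 → Fin (m + 1) × Fin (m + 1)) (j : ℕ)
    (s : List (ProtocolSymbol m)) :
    val θ P w h (.flip st) 0 j s =
      θ.heads * val θ P w h (.query ⟨st, 0, true, true, false⟩) 0 j (.announce true :: s) +
        (1 - θ.heads) *
          val θ P w h (.query ⟨st, 0, true, false, false⟩) 0 j (.announce false :: s) := by
  have h1 := (protocol m θ).value_toss (k := k) P w hh (q := .flip st) rfl 0 j s
  have h2 := fun a => (protocol m θ).value_talk (k := k) P w hh (q := .announce st a) rfl 0 j s
  rw [h2, h2] at h1
  exact h1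

theorem val_query (c : Scan m) {x j : ℕ} (hx : x ≤ wordIndex w) (hj : j < (k + 1) ^ w.length)
    (s : List (ProtocolSymbol m)) :
    val θ P w h (.query c) x j s =
      val θ P w h (c.continue (P w (.query :: s)).toDigits (decide (x = j))
        (decide (x = wordIndex w))) (if x = wordIndex w then 0 else x + 1) j (.query :: s) := by
  have h1 := (protocol m θ).value_talk (k := k) P w hh (q := .query c) rfl x j s
  have h2 := (protocol m θ).value_tick (k := k) P w hh
    (q := .got c (P w (.query :: s)).toDigits) rfl hx hj (.query :: s)
  exact h1.trans h2

end Protocol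

/-! ### Correct dictation and detection of the first false digit -/

namespace Protocol

variable {m : ℕ}

/-- The digits of two numbers. -/
def digitsAt (m l t u : ℕ) : Fin (m + 1) × Fin (m + 1) :=
  (digit m l t, digit m l u)

/-- The digits that the verifier has stored for the target position `j` if there are `N + 1` positions
in each phase. -/
def storedAt (m N j t u : ℕ) : Fin 7 → Fin (m + 1) × Fin (m + 1) :=
  fun φ => if j ≤ N then digitsAt m (φ * (N + 1) + j) t u else (0, 0)

theorem storedAt_zero (m N j : ℕ) : storedAt m N j 0 0 = fun _ => (0, 0) := by
  funext φ
  simp [storedAt, digitsAt, digit_zero]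

/-- The number of heads after a toss. -/
def addToss (u : ℕ) (a : Bool) : ℕ :=
  if a then u + 1 else u

/-- What the verifier remembers when it has received the first `l` digits of the numbers `t + 1` and
`addToss u a`, and has stored digits of `t` and `u` before. -/
def scanAt (m N j t u : ℕ) (a : Bool) (l : ℕ) : Scan m where
  stored φ := if φ * (N + 1) + j < l then storedAt m N j (t + 1) (addToss u a) φ
    else storedAt m N j t u φ
  phase := Fin.ofNat 7 (l / (N + 1))
  carryTosses := decide ((m + 1) ^ l ∣ t + 1)
  carryHeads := a && decide ((m + 1) ^ l ∣ u + 1)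
  claim := decide (6 * (N + 1) ≤ l ∧ digit m (6 * (N + 1) - 1) (addToss u a) = 2)

theorem scanAt_zero (m N j t u : ℕ) (a : Bool) :
    scanAt m N j t u a 0 = ⟨storedAt m N j t u, 0, true, a, false⟩ := by
  simp [scanAt]

theorem mod_succ_eq_ite (l N : ℕ) :
    (l + 1) % (N + 1) = if l % (N + 1) = N then 0 else l % (N + 1) + 1 := by
  have hml : l % (N + 1) < N + 1 := Nat.mod_lt l (Nat.succ_pos N)
  split_ifs with h
  · rw [Nat.succ_mod_succ_eq_zero_iff, h]
  · rw [← Nat.mod_add_mod, Nat.mod_eq_of_lt (by omega)]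

theorem val_phase {N l : ℕ} (hl : l < 7 * (N + 1)) :
    (Fin.ofNat 7 (l / (N + 1))).val = l / (N + 1) := by
  rw [Fin.val_ofNat, Nat.mod_eq_of_lt]
  rwa [Nat.div_lt_iff_lt_mul (by omega)]

/-- At a place congruent to the target, the digit stored in the previous round together with the
current carry determines the new digit. The carry comes from the dictated digits, which have been
correct so far. -/
theorem expected_scanAt {N j t u l : ℕ} {a : Bool} (hl : l < 7 * (N + 1)) (hj : l % (N + 1) = j) :
    (scanAt m N j t u a l).expected = digitsAt m l (t + 1) (addToss u a) := by
  have hjN : j ≤ N := by have : l % (N + 1) < N + 1 := Nat.mod_lt l (Nat.succ_pos N); omega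
  have hlj : l / (N + 1) * (N + 1) + j = l := by rw [← hj]; exact Nat.div_add_mod' _ _
  have hs : (scanAt m N j t u a l).stored (scanAt m N j t u a l).phase = digitsAt m l t u := by
    simp only [scanAt, storedAt, val_phase hl, hlj, hjN, if_true, lt_irrefl, if_false]
  rw [Scan.expected, hs]
  simp only [scanAt, digitsAt, digit_succ m l t, decide_eq_true_eq]
  cases a
  · simp [addToss]
  · simp [addToss, digit_succ m l u]

theorem next_scanAt {N j t u l : ℕ} {a : Bool} (hl : l < 7 * (N + 1)) :
    (scanAt m N j t u a l).next (digitsAt m l (t + 1) (addToss u a)) (decide (l % (N + 1) = j))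
      (decide (l % (N + 1) = N)) = scanAt m N j t u a (l + 1) := by
  have hdm := Nat.div_add_mod' l (N + 1)
  have hml : l % (N + 1) < N + 1 := Nat.mod_lt l (Nat.succ_pos N)
  have hph := val_phase hl
  rw [Scan.next, scanAt, scanAt, Scan.mk.injEq]
  refine ⟨?_, ?_, ?_, ?_, ?_⟩
  · funext φ
    simp only [decide_eq_true_eq]
    by_cases hj : l % (N + 1) = j
    · rw [if_pos hj]
      have hjN : j ≤ N := by omega
      by_cases hφ : φ = Fin.ofNat 7 (l / (N + 1))
      · rw [hφ, Function.update_self, hph, ← hj, hdm, if_pos (by omega), storedAt,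
          if_pos (by omega), hph, hdm]
      · rw [Function.update_of_ne hφ]
        have hne : φ.val * (N + 1) + j ≠ l := by
          intro h
          apply hφ
          apply Fin.ext
          rw [hph]
          have : φ.val * (N + 1) = l / (N + 1) * (N + 1) := by omega
          exact Nat.eq_of_mul_eq_mul_right (Nat.succ_pos N) this
        have : φ.val * (N + 1) + j < l + 1 ↔ φ.val * (N + 1) + j < l := by omega
        simp only [this]
    · rw [if_neg hj]
      by_cases hjN : j ≤ N
      · have hne : φ.val * (N + 1) + j ≠ l := by
          intro h
          apply hj
          rw [← h, mul_comm, Nat.mul_add_mod, Nat.mod_eq_of_lt (by omega)]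
        have : φ.val * (N + 1) + j < l + 1 ↔ φ.val * (N + 1) + j < l := by omega
        simp only [this]
      · simp [storedAt, hjN]
  · simp only [decide_eq_true_eq]
    split_ifs with hN
    · have : (l + 1) / (N + 1) = l / (N + 1) + 1 := by
        have h1 : l + 1 = (l / (N + 1) + 1) * (N + 1) := by rw [add_mul]; omega
        rw [h1, Nat.mul_div_cancel _ (Nat.succ_pos N)]
      rw [this]
      simp [Fin.ext_iff, Fin.val_add]
    · have : (l + 1) / (N + 1) = l / (N + 1) := by
        have h1 : l + 1 = l % (N + 1) + 1 + l / (N + 1) * (N + 1) := by omega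
        conv_lhs => rw [h1]
        rw [Nat.add_mul_div_right _ _ (Nat.succ_pos N), Nat.div_eq_of_lt (by omega), zero_add]
      rw [this]
  · rw [Bool.eq_iff_iff]
    simp [digitsAt, pow_succ_dvd_iff_digit]
    exact fun _ => decide_eq_true_iff
  · cases a
    · simp
    · rw [Bool.eq_iff_iff]
      simp [digitsAt, addToss, pow_succ_dvd_iff_digit]
  · have hph5 : (Fin.ofNat 7 (l / (N + 1)) = 5) ↔ l / (N + 1) = 5 := by
      rw [Fin.ext_iff, hph]; rfl
    simp only [decide_eq_true_eq, hph5]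
    by_cases hl6 : l + 1 = 6 * (N + 1)
    · have hd : l / (N + 1) = 5 := by
        have h1 : l = N + 5 * (N + 1) := by omega
        rw [h1, Nat.add_mul_div_right _ _ (Nat.succ_pos N), Nat.div_eq_of_lt (by omega)]
      have hm : l % (N + 1) = N := by rw [hd] at hdm; omega
      have hl6' : 6 * (N + 1) - 1 = l := by omega
      rw [if_pos ⟨hm, hd⟩, hl6', Bool.eq_iff_iff]
      simp [digitsAt, hl6]
      exact decide_eq_true_iff
    · rw [if_neg]
      · have : 6 * (N + 1) ≤ l + 1 ↔ 6 * (N + 1) ≤ l := by omega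
        simp only [this]
      · rintro ⟨h1, h2⟩
        rw [h1, h2] at hdm
        omega

/-- The state after the dictation of the `7 * (N + 1)` digits of `t` and `u`. -/
def afterScan (m N j t u : ℕ) : ProtocolState m :=
  if (m + 1) ^ (7 * (N + 1)) ∣ t then
    if digit m (6 * (N + 1) - 1) u = 2 then .gate true else .reject
  else .clock (storedAt m N j t u) true

/-- A correct digit never causes a rejection by the check, for any target; so a correct dictation
leads to the same branch for all targets. -/
theorem continue_scanAt {N j t u l : ℕ} {a : Bool} (hl : l < 7 * (N + 1)) :
    (scanAt m N j t u a l).continue (digitsAt m l (t + 1) (addToss u a))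
      (decide (l % (N + 1) = j)) (decide (l % (N + 1) = N)) =
      if l + 1 = 7 * (N + 1) then afterScan m N j (t + 1) (addToss u a)
      else .query (scanAt m N j t u a (l + 1)) := by
  have hdm := Nat.div_add_mod' l (N + 1)
  have hph := val_phase hl
  have hph6 : (scanAt m N j t u a l).phase = 6 ↔ l / (N + 1) = 6 := by
    rw [Fin.ext_iff, scanAt, hph]; rfl
  rw [Scan.continue, if_neg, next_scanAt hl]
  · have : (decide (l % (N + 1) = N) = true ∧ (scanAt m N j t u a l).phase = 6) ↔
        l + 1 = 7 * (N + 1) := by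
      rw [hph6, decide_eq_true_eq]
      constructor
      · rintro ⟨h1, h2⟩
        rw [h1, h2] at hdm
        omega
      · intro h
        have hd : l / (N + 1) = 6 := by
          have h1 : l = N + 6 * (N + 1) := by omega
          rw [h1, Nat.add_mul_div_right _ _ (Nat.succ_pos N), Nat.div_eq_of_lt (by omega)]
        rw [hd] at hdm
        exact ⟨by omega, hd⟩
    simp only [this]
    split_ifs with hlast hc hcl
    · simp only [scanAt, hlast, decide_eq_true_eq] at hc hcl
      rw [afterScan, if_pos hc, if_pos hcl.2]
    · simp only [scanAt, hlast, decide_eq_true_eq] at hc hcl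
      rw [afterScan, if_pos hc, if_neg fun h => hcl ⟨by omega, h⟩]
    · simp only [scanAt, hlast, decide_eq_true_eq] at hc
      rw [afterScan, if_neg hc]
      congr 1
      funext φ
      simp only [scanAt, hlast]
      split_ifs with hφ
      · rfl
      · have hjN : ¬ j ≤ N := by
          intro hjN
          have h7 := φ.2
          have : φ.val * (N + 1) ≤ 6 * (N + 1) := Nat.mul_le_mul_right _ (by omega)
          omega
        simp [storedAt, hjN]
    · rfl
  · rintro ⟨h1, h2⟩
    exact h2 (expected_scanAt hl (by simpa using h1)).symm

variable {k : ℕ} (θ : ProtocolCoins) (P : List (Fin k) → List (ProtocolSymbol m) → ProtocolSymbol m)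
  (w : List (Fin k)) {h : VerifierState (Stage (ProtocolState m)) (ProtocolState m)}

/-- The digits that the prover dictates, beginning after the sent symbols `s`. -/
def dictated (s : List (ProtocolSymbol m)) (l : ℕ) : Fin (m + 1) × Fin (m + 1) :=
  (P w (List.replicate (l + 1) .query ++ s)).toDigits

theorem val_query_scanAt_step (hh : h.IsHalting) {j t u l : ℕ} {a : Bool}
    (hl : l < 7 * (wordIndex w + 1)) (hj : j < (k + 1) ^ w.length) {s : List (ProtocolSymbol m)}
    (hd : dictated P w s l = digitsAt m l (t + 1) (addToss u a)) :
    val θ P w h (.query (scanAt m (wordIndex w) j t u a l)) (l % (wordIndex w + 1)) j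
        (List.replicate l .query ++ s) =
      val θ P w h (if l + 1 = 7 * (wordIndex w + 1) then
          afterScan m (wordIndex w) j (t + 1) (addToss u a)
        else .query (scanAt m (wordIndex w) j t u a (l + 1))) ((l + 1) % (wordIndex w + 1)) j
        (List.replicate (l + 1) .query ++ s) := by
  have hml : l % (wordIndex w + 1) < wordIndex w + 1 := Nat.mod_lt l (Nat.succ_pos _)
  have hd' : (P w (.query :: (List.replicate l .query ++ s))).toDigits =
    digitsAt m l (t + 1) (addToss u a) := hd
  rw [val_query θ P w hh _ (by omega) hj, hd', continue_scanAt hl]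
  congr 1
  rw [mod_succ_eq_ite l (wordIndex w)]

theorem val_query_scanAt_prefix (hh : h.IsHalting) {j t u : ℕ} {a : Bool}
    (hj : j < (k + 1) ^ w.length) {s : List (ProtocolSymbol m)} {l : ℕ}
    (hl : l < 7 * (wordIndex w + 1))
    (hd : ∀ l' < l, dictated P w s l' = digitsAt m l' (t + 1) (addToss u a)) :
    val θ P w h (.query ⟨storedAt m (wordIndex w) j t u, 0, true, a, false⟩) 0 j s =
      val θ P w h (.query (scanAt m (wordIndex w) j t u a l)) (l % (wordIndex w + 1)) j
        (List.replicate l .query ++ s) := by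
  induction l with
  | zero => rw [scanAt_zero, Nat.zero_mod]; rfl
  | succ l ih =>
    rw [ih (by omega) fun l' h => hd l' (by omega),
      val_query_scanAt_step θ P w hh (by omega) hj (hd l (by omega)), if_neg (by omega)]

theorem val_query_of_dictated_eq (hh : h.IsHalting) {j t u : ℕ} {a : Bool}
    (hj : j < (k + 1) ^ w.length) {s : List (ProtocolSymbol m)}
    (hd : ∀ l < 7 * (wordIndex w + 1),
      dictated P w s l = digitsAt m l (t + 1) (addToss u a)) :
    val θ P w h (.query ⟨storedAt m (wordIndex w) j t u, 0, true, a, false⟩) 0 j s =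
      val θ P w h (afterScan m (wordIndex w) j (t + 1) (addToss u a)) 0 j
        (List.replicate (7 * (wordIndex w + 1)) .query ++ s) := by
  have hl : 7 * (wordIndex w + 1) - 1 < 7 * (wordIndex w + 1) := by omega
  have hl' : 7 * (wordIndex w + 1) - 1 + 1 = 7 * (wordIndex w + 1) := by omega
  rw [val_query_scanAt_prefix θ P w hh hj hl fun l' h => hd l' (by omega),
    val_query_scanAt_step θ P w hh hl hj (hd _ hl), if_pos hl', hl', Nat.mul_mod_left]

/-- The correct digits before `l` keep the carries and the stored digits correct, so with the
matching target the first false digit is rejected at once, with certainty. -/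
theorem val_query_of_dictated_ne {j t u : ℕ} {a : Bool} (hj : j < (k + 1) ^ w.length)
    {s : List (ProtocolSymbol m)} {l : ℕ} (hl : l < 7 * (wordIndex w + 1))
    (hd : ∀ l' < l, dictated P w s l' = digitsAt m l' (t + 1) (addToss u a))
    (hne : dictated P w s l ≠ digitsAt m l (t + 1) (addToss u a))
    (hlj : l % (wordIndex w + 1) = j) :
    val θ P w .reject (.query ⟨storedAt m (wordIndex w) j t u, 0, true, a, false⟩) 0 j s = 1 := by
  have hml : l % (wordIndex w + 1) < wordIndex w + 1 := Nat.mod_lt l (Nat.succ_pos _)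
  rw [val_query_scanAt_prefix θ P w (h := .reject) trivial hj hl hd, val_query θ P w (h := .reject) trivial _ (by omega) hj,
    Scan.continue, if_pos, val_reject]
  refine ⟨by simpa using hlj, ?_⟩
  rw [expected_scanAt hl hlj]
  exact hne

end Protocol

/-! ### Concentration of the number of heads -/

/-- The probability that the number of heads is good after `n` more tosses of a coin with bias `p`,
when it is `u` now. -/
noncomputable def goodProb (p : ℝ) (good : ℕ → Prop) : ℕ → ℕ → ℝ
  | 0, u => by classical exact if good u then 1 else 0
  | n + 1, u => p * goodProb p good n (u + 1) + (1 - p) * goodProb p good n u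

theorem goodProb_zero_of {p : ℝ} {good : ℕ → Prop} {u : ℕ} (hu : good u) :
    goodProb p good 0 u = 1 := if_pos hu

theorem goodProb_zero_of_not {p : ℝ} {good : ℕ → Prop} {u : ℕ} (hu : ¬ good u) :
    goodProb p good 0 u = 0 := if_neg hu

theorem goodProb_le_one {p : ℝ} (hp0 : 0 ≤ p) (hp1 : p ≤ 1) (good : ℕ → Prop) (n u : ℕ) :
    goodProb p good n u ≤ 1 := by
  induction n generalizing u with
  | zero =>
    by_cases hu : good u
    · rw [goodProb_zero_of hu]
    · rw [goodProb_zero_of_not hu]; norm_num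
  | succ n ih =>
    rw [goodProb]
    nlinarith [ih u, ih (u + 1)]

/-- Chebyshev's inequality for the number of heads. -/
theorem one_sub_goodProb_le {p : ℝ} (hp0 : 0 ≤ p) (hp1 : p ≤ 1) {good : ℕ → Prop} {c D : ℝ}
    (hD : 0 < D) (hgood : ∀ u : ℕ, ¬ good u → D ≤ |u - c|) (n u : ℕ) :
    1 - goodProb p good n u ≤ ((u + n * p - c) ^ 2 + n * (p * (1 - p))) / D ^ 2 := by
  induction n generalizing u with
  | zero =>
    by_cases hu : good u
    · rw [goodProb_zero_of hu, sub_self]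
      have : 0 ≤ p * (1 - p) := mul_nonneg hp0 (sub_nonneg.2 hp1)
      positivity
    · rw [goodProb_zero_of_not hu, sub_zero, one_le_div (by positivity)]
      have := pow_le_pow_left₀ hD.le (hgood u hu) 2
      rw [sq_abs] at this
      simpa using this
  | succ n ih =>
    rw [goodProb]
    have h1 := mul_le_mul_of_nonneg_left (ih (u + 1)) hp0
    have h2 := mul_le_mul_of_nonneg_left (ih u) (sub_nonneg.2 hp1)
    -- The numerator is the expected square of the final distance to `c`, which obeys the recursion
    -- for one toss with equality. Only the case of no remaining tosses loses anything.
    calc _ = p * (1 - goodProb p good n (u + 1)) + (1 - p) * (1 - goodProb p good n u) := by ring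
      _ ≤ _ := add_le_add h1 h2
      _ = _ := by
        push_cast
        field_simp
        ring

/-- Supplies a worst case over all histories of a nonterminating computation: a one-step estimate
valid for every history becomes an inequality for the infimum. -/
theorem exists_greatest_lower_bound {ι : Type*} [Nonempty ι] (f : ι → ℝ) (h0 : ∀ i, 0 ≤ f i)
    (h1 : ∀ i, f i ≤ 1) :
    ∃ r, 0 ≤ r ∧ r ≤ 1 ∧ (∀ i, r ≤ f i) ∧ ∀ z, (∀ i, z ≤ f i) → z ≤ r := by
  have hb : BddBelow (Set.range f) := ⟨0, by rintro _ ⟨i, rfl⟩; exact h0 i⟩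
  exact ⟨⨅ i, f i, le_ciInf h0, (ciInf_le hb (Classical.arbitrary ι)).trans (h1 _),
    fun i => ciInf_le hb i, fun z hz => le_ciInf hz⟩

/-! ### Recursive inequalities for one repetition -/

namespace Protocol

variable {m k : ℕ} (θ : ProtocolCoins) (P : List (Fin k) → List (ProtocolSymbol m) → ProtocolSymbol m)
  (w : List (Fin k))

/-- Whatever the prover says, a scan ends after its remaining `n` digits in a rejection, a new round
or the gate; a bound valid at these exits is valid throughout the scan. The scan `c` is arbitrary,
since lies may have spoiled its contents. -/
theorem le_val_query {h : VerifierState (Stage (ProtocolState m)) (ProtocolState m)}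
    (hh : h.IsHalting) {j : ℕ} (hj : j < (k + 1) ^ w.length) {z : ℝ}
    (hclock : ∀ st s, z ≤ val θ P w h (.clock st true) 0 j s)
    (hgate : ∀ s, z ≤ val θ P w h (.gate true) 0 j s)
    (hreject : ∀ x s, z ≤ val θ P w h .reject x j s) (n : ℕ) (c : Scan m) (x : ℕ)
    (s : List (ProtocolSymbol m)) (hx : x ≤ wordIndex w)
    (hn : n + (c.phase * (wordIndex w + 1) + x) = 7 * (wordIndex w + 1)) :
    z ≤ val θ P w h (.query c) x j s := by
  induction n generalizing c x s with
  | zero =>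
    have : c.phase.val * (wordIndex w + 1) ≤ 6 * (wordIndex w + 1) :=
      Nat.mul_le_mul_right _ (by omega)
    omega
  | succ n ih =>
    rw [val_query θ P w hh c hx hj, Scan.continue]
    by_cases hw : x = wordIndex w
    · simp only [hw, decide_true, true_and, if_true]
      split_ifs with h1 h2 h3 h4
      · exact hreject _ _
      · exact hgate _
      · exact hreject _ _
      · exact hclock _ _
      · refine ih _ _ _ (Nat.zero_le _) ?_
        have hv : (c.phase + 1).val = c.phase.val + 1 := by
          rw [Fin.val_add_one, if_neg]
          exact h2
        simp only [Scan.next, if_true, hv]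
        subst hw
        rw [add_mul]
        omega
    · simp only [hw, decide_false, Bool.false_eq_true, false_and, if_false]
      split_ifs with h1
      · exact hreject _ _
      · refine ih _ _ _ (by omega) ?_
        simp only [Scan.next, Bool.false_eq_true, if_false]
        omega

variable {good : ℕ → Prop}

theorem clock_pow_mem (n : ℕ) : 0 ≤ (θ.clock : ℝ) ^ n ∧ (θ.clock : ℝ) ^ n ≤ 1 :=
  ⟨pow_nonneg θ.clock.2.1 n, pow_le_one₀ θ.clock.2.1 θ.clock.2.2⟩

theorem gate_pow_mem (n : ℕ) : 0 ≤ (θ.gate : ℝ) ^ n ∧ (θ.gate : ℝ) ^ n ≤ 1 :=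
  ⟨pow_nonneg θ.gate.2.1 n, pow_le_one₀ θ.gate.2.1 θ.gate.2.2⟩

/-- Everywhere in a repetition, rejection is at least as probable as at its successful end. -/
theorem le_val_clock (hκ : 0 < (θ.clock : ℝ)) {j : ℕ} (hj : j < (k + 1) ^ w.length) {β : ℝ}
    (hβ : β ≤ 1) (hgate : ∀ s, β ≤ val θ P w .reject (.gate true) 0 j s)
    (st : Fin 7 → Fin (m + 1) × Fin (m + 1)) (s : List (ProtocolSymbol m)) :
    β ≤ val θ P w .reject (.clock st true) 0 j s := by
  -- The infimum runs over all stored digits and histories, because undetected lies can leave any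
  -- digits in the memory.
  obtain ⟨b, hb0, hb1, hb, hbz⟩ := exists_greatest_lower_bound
    (fun i : (Fin 7 → Fin (m + 1) × Fin (m + 1)) × List (ProtocolSymbol m) =>
      val θ P w .reject (.clock i.1 true) 0 j i.2)
    (fun i => val_nonneg _ _ _ _ _ _ _ _) (fun i => val_le_one _ _ _ _ _ _ _ _)
  have hz : ∀ c s, c.phase = 0 → min b β ≤ val θ P w .reject (.query c) 0 j s := by
    intro c s hc
    refine le_val_query θ P w (h := .reject) trivial hj (fun st s => (min_le_left _ _).trans (hb (st, s)))
      (fun s => (min_le_right _ _).trans (hgate s)) (fun x s => ?_)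
      (7 * (wordIndex w + 1)) c 0 s (Nat.zero_le _) ?_
    · rw [val_reject]
      exact (min_le_right _ _).trans hβ
    · simp [hc]
  obtain ⟨hα0, hα1⟩ := θ.heads.2
  set κ := (θ.clock : ℝ) ^ (wordIndex w + 1) with hκd
  have hκ0 : 0 < κ := pow_pos hκ _
  have hκ1 : κ ≤ 1 := (clock_pow_mem θ _).2
  have hbm : κ + (1 - κ) * min b β ≤ b := by
    refine hbz _ fun i => ?_
    rw [val_clock θ P w (h := .reject) trivial _ hj, val_flip θ P w (h := .reject) trivial, val_reject,
      mul_one]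
    have h1 := hz ⟨i.1, 0, true, true, false⟩ (.announce true :: i.2) rfl
    have h2 := hz ⟨i.1, 0, true, false, false⟩ (.announce false :: i.2) rfl
    have h3 := mul_le_mul_of_nonneg_left h1 hα0
    have h4 := mul_le_mul_of_nonneg_left h2 (sub_nonneg.2 hα1)
    have h5 := (le_of_eq (by ring : min b β = θ.heads * min b β + (1 - θ.heads) * min b β)).trans
      (add_le_add h3 h4)
    exact add_le_add le_rfl (mul_le_mul_of_nonneg_left h5 (sub_nonneg.2 hκ1))
  refine le_trans ?_ (hb (st, s))
  -- If `b < β`, then `κ + (1 - κ) * b ≤ b`, so the positive clock probability forces `b ≥ 1 ≥ β`.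
  -- This is how endless repetitions are excluded.
  by_contra! hlt
  rw [min_eq_left hlt.le] at hbm
  nlinarith

/-- The history `s` is the same for all targets, so the prover acts identically for all of them.
Either the whole dictation is correct, or its first false digit raises the term of one target from
`β` to 1. This gain `1 - β` is at least the gain `(1 - β) * G` that correct dictation would bring.
-/
theorem sum_val_query_ge {t u : ℕ} {β : ℝ} (hβ : β ≤ 1)
    (hP : wordIndex w + 1 ≤ (k + 1) ^ w.length) (a : Bool) (s : List (ProtocolSymbol m))
    {G : ℝ} (hG : G ≤ 1)
    (hany : ∀ j < wordIndex w + 1,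
      β ≤ val θ P w .reject (.query ⟨storedAt m (wordIndex w) j t u, 0, true, a, false⟩) 0 j s)
    (hafter : ∀ s', (wordIndex w + 1 : ℕ) * β + (1 - β) * G ≤
      ∑ j ∈ Finset.range (wordIndex w + 1),
        val θ P w .reject (afterScan m (wordIndex w) j (t + 1) (addToss u a)) 0 j s') :
    (wordIndex w + 1 : ℕ) * β + (1 - β) * G ≤ ∑ j ∈ Finset.range (wordIndex w + 1),
      val θ P w .reject (.query ⟨storedAt m (wordIndex w) j t u, 0, true, a, false⟩) 0 j s := by
  by_cases hd : ∀ l < 7 * (wordIndex w + 1),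
      dictated P w s l = digitsAt m l (t + 1) (addToss u a)
  · refine (hafter (List.replicate (7 * (wordIndex w + 1)) .query ++ s)).trans_eq ?_
    refine Finset.sum_congr rfl fun j hj => ?_
    rw [val_query_of_dictated_eq θ P w (h := .reject) trivial
      ((Finset.mem_range.1 hj).trans_le hP) hd]
  · push Not at hd
    classical
    obtain ⟨hl, hne⟩ := Nat.find_spec hd
    set l := Nat.find hd
    have hmin : ∀ l' < l, dictated P w s l' = digitsAt m l' (t + 1) (addToss u a) := by
      intro l' hl'
      have := Nat.find_min hd hl'
      push Not at this
      exact this (hl'.trans hl)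
    have hjl : l % (wordIndex w + 1) < wordIndex w + 1 := Nat.mod_lt _ (Nat.succ_pos _)
    calc (wordIndex w + 1 : ℕ) * β + (1 - β) * G
        ≤ (wordIndex w + 1 : ℕ) * β + (1 - β) := by nlinarith
      _ = ∑ j ∈ Finset.range (wordIndex w + 1),
          (β + if j = l % (wordIndex w + 1) then 1 - β else 0) := by
        rw [Finset.sum_add_distrib, Finset.sum_ite_eq' _ _, if_pos (Finset.mem_range.2 hjl)]
        simp
      _ ≤ _ := by
        refine Finset.sum_le_sum fun j hj => ?_
        split_ifs with hjl'
        · rw [val_query_of_dictated_ne θ P w ((Finset.mem_range.1 hj).trans_le hP) hl hmin hne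
            hjl'.symm]
          linarith
        · rw [add_zero]
          exact hany j (Finset.mem_range.1 hj)

/-- Averaging over the counted toss reproduces the recursion of `goodProb`. The clock only helps,
since it rejects and the claimed bound is at most the number of summands. -/
theorem sum_val_clock_ge_of_after (hκ : 0 < (θ.clock : ℝ)) {β : ℝ} (hβ : β ≤ 1)
    (hgate : ∀ j < (k + 1) ^ w.length, ∀ s, β ≤ val θ P w .reject (.gate true) 0 j s)
    {n t u : ℕ}
    (hafter : ∀ a s, (wordIndex w + 1 : ℕ) * β + (1 - β) * goodProb θ.heads good n (addToss u a) ≤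
      ∑ j ∈ Finset.range (wordIndex w + 1),
        val θ P w .reject (afterScan m (wordIndex w) j (t + 1) (addToss u a)) 0 j s)
    (s : List (ProtocolSymbol m)) :
    (wordIndex w + 1 : ℕ) * β + (1 - β) * goodProb θ.heads good (n + 1) u ≤
      ∑ j ∈ Finset.range (wordIndex w + 1),
        val θ P w .reject (.clock (storedAt m (wordIndex w) j t u) true) 0 j s := by
  have hP : wordIndex w + 1 ≤ (k + 1) ^ w.length := wordIndex_lt w
  obtain ⟨hα0, hα1⟩ := θ.heads.2
  obtain ⟨hκ0, hκ1⟩ := clock_pow_mem θ (wordIndex w + 1)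
  have hg := fun n u => goodProb_le_one hα0 hα1 good n u
  set Y : Bool → ℝ := fun a => ∑ j ∈ Finset.range (wordIndex w + 1),
    val θ P w .reject (.query ⟨storedAt m (wordIndex w) j t u, 0, true, a, false⟩) 0 j
      (.announce a :: s) with hYd
  have hY : ∀ a, (wordIndex w + 1 : ℕ) * β +
      (1 - β) * goodProb θ.heads good n (addToss u a) ≤ Y a := by
    intro a
    refine sum_val_query_ge θ P w hβ hP a _ (hg _ _) (fun j hj => ?_) (hafter a)
    have hj' := hj.trans_le hP
    refine le_val_query θ P w (h := .reject) trivial hj' (le_val_clock θ P w hκ hj' hβ (hgate j hj'))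
      (hgate j hj') (fun x s => ?_) (7 * (wordIndex w + 1)) _ 0 _ (Nat.zero_le _) (by simp)
    rw [val_reject]
    exact hβ
  have hsum : ∑ j ∈ Finset.range (wordIndex w + 1),
      val θ P w .reject (.clock (storedAt m (wordIndex w) j t u) true) 0 j s =
      θ.clock ^ (wordIndex w + 1) * (wordIndex w + 1 : ℕ) +
        (1 - θ.clock ^ (wordIndex w + 1)) * (θ.heads * Y true + (1 - θ.heads) * Y false) := by
    have : ∀ j ∈ Finset.range (wordIndex w + 1),
        val θ P w .reject (.clock (storedAt m (wordIndex w) j t u) true) 0 j s =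
          θ.clock ^ (wordIndex w + 1) * 1 + (1 - θ.clock ^ (wordIndex w + 1)) *
          (θ.heads * val θ P w .reject (.query ⟨storedAt m (wordIndex w) j t u, 0, true, true,
              false⟩) 0 j (.announce true :: s) +
            (1 - θ.heads) * val θ P w .reject (.query ⟨storedAt m (wordIndex w) j t u, 0, true,
              false, false⟩) 0 j (.announce false :: s)) := by
      intro j hj
      rw [val_clock θ P w (h := .reject) trivial _ ((Finset.mem_range.1 hj).trans_le hP),
        val_flip θ P w (h := .reject) trivial, val_reject]
    rw [Finset.sum_congr rfl this, Finset.sum_add_distrib, ← Finset.mul_sum, ← Finset.mul_sum,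
      Finset.sum_add_distrib, ← Finset.mul_sum, ← Finset.mul_sum]
    simp [hYd]
  rw [hsum]
  have h1 := mul_le_mul_of_nonneg_left (hY true) hα0
  have h2 := mul_le_mul_of_nonneg_left (hY false) (sub_nonneg.2 hα1)
  have h3 : (wordIndex w + 1 : ℕ) * β + (1 - β) * goodProb θ.heads good (n + 1) u ≤
      θ.heads * Y true + (1 - θ.heads) * Y false := by
    refine le_trans (le_of_eq ?_) (add_le_add h1 h2)
    simp only [goodProb, addToss, if_true, Bool.false_eq_true, if_false]
    ring
  have h4 : (wordIndex w + 1 : ℕ) * β + (1 - β) * goodProb θ.heads good (n + 1) u ≤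
      (wordIndex w + 1 : ℕ) := by
    have h5 := hg (n + 1) u
    have h6 : (1 : ℝ) ≤ (wordIndex w + 1 : ℕ) := by exact_mod_cast Nat.succ_pos _
    nlinarith
  nlinarith

/-- Backward induction from the wrap-around, where `n` is the number of tosses still to come. At the
wrap-around a good number of heads is rejected for every target; gaining `1 - β` for a single one
would suffice. -/
theorem sum_val_afterScan_ge (hκ : 0 < (θ.clock : ℝ)) {β : ℝ} (hβ : β ≤ 1)
    (hgate : ∀ j < (k + 1) ^ w.length, ∀ s, β ≤ val θ P w .reject (.gate true) 0 j s)
    (hgood : ∀ u, good u → digit m (6 * (wordIndex w + 1) - 1) u ≠ 2) (n t u : ℕ)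
    (ht : t + 1 + n = (m + 1) ^ (7 * (wordIndex w + 1))) (s : List (ProtocolSymbol m)) :
    (wordIndex w + 1 : ℕ) * β + (1 - β) * goodProb θ.heads good n u ≤
      ∑ j ∈ Finset.range (wordIndex w + 1),
        val θ P w .reject (afterScan m (wordIndex w) j (t + 1) u) 0 j s := by
  have hP : wordIndex w + 1 ≤ (k + 1) ^ w.length := wordIndex_lt w
  induction n generalizing t u s with
  | zero =>
    by_cases hu : good u
    · have : ∀ j ∈ Finset.range (wordIndex w + 1),
          val θ P w .reject (afterScan m (wordIndex w) j (t + 1) u) 0 j s = 1 := by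
        intro j _
        rw [afterScan, if_pos (by rw [← ht]), if_neg (hgood u hu), val_reject]
      rw [Finset.sum_congr rfl this, goodProb_zero_of hu]
      have h6 : (1 : ℝ) ≤ (wordIndex w + 1 : ℕ) := by exact_mod_cast Nat.succ_pos _
      rw [Finset.sum_const, Finset.card_range, nsmul_eq_mul]
      nlinarith
    · rw [goodProb_zero_of_not hu, mul_zero, add_zero]
      have : ∀ j ∈ Finset.range (wordIndex w + 1),
          β ≤ val θ P w .reject (afterScan m (wordIndex w) j (t + 1) u) 0 j s := by
        intro j hj
        rw [afterScan, if_pos (by rw [← ht])]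
        split_ifs
        · exact hgate j ((Finset.mem_range.1 hj).trans_le hP) s
        · rw [val_reject]
          exact hβ
      refine le_trans (le_of_eq ?_) (Finset.sum_le_sum this)
      simp
  | succ n ih =>
    have hnd : ¬ (m + 1) ^ (7 * (wordIndex w + 1)) ∣ t + 1 := by
      rw [← ht]
      intro hdvd
      have := Nat.le_of_dvd (Nat.succ_pos t) hdvd
      omega
    simp only [afterScan, if_neg hnd]
    exact sum_val_clock_ge_of_after θ P w hκ hβ hgate
      (fun a s => ih (t + 1) (addToss u a) (by omega) s) s

/-- The probability of rejection `r` at the start of a repetition satisfies a recursive inequality if the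
good numbers of heads lead to rejection. -/
theorem soundness_bound (hκ : 0 < (θ.clock : ℝ))
    (hgood : ∀ u, good u → digit m (6 * (wordIndex w + 1) - 1) u ≠ 2) :
    ∃ r, 0 ≤ r ∧ r ≤ 1 ∧ r ≤ val θ P w .reject .reset 0 0 [] ∧
      (1 - θ.gate ^ (wordIndex w + 1)) * r + (1 - (1 - θ.gate ^ (wordIndex w + 1)) * r) *
        goodProb θ.heads good ((m + 1) ^ (7 * (wordIndex w + 1))) 0 / ((k + 1) ^ w.length : ℕ)
        ≤ r := by
  have hP : wordIndex w + 1 ≤ (k + 1) ^ w.length := wordIndex_lt w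
  obtain ⟨hq0, hq1⟩ := gate_pow_mem θ (wordIndex w + 1)
  have hB : 0 < (k + 1) ^ w.length := by positivity
  have : Nonempty {j // j < (k + 1) ^ w.length} := ⟨⟨0, hB⟩⟩
  obtain ⟨r, hr0, hr1, hr, hrz⟩ := exists_greatest_lower_bound
    (fun i : {j // j < (k + 1) ^ w.length} × List (ProtocolSymbol m) =>
      val θ P w .reject .reset 0 i.1 i.2)
    (fun i => val_nonneg _ _ _ _ _ _ _ _) (fun i => val_le_one _ _ _ _ _ _ _ _)
  refine ⟨r, hr0, hr1, hr (⟨0, hB⟩, []), hrz _ ?_⟩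
  rintro ⟨⟨j, hj⟩, s⟩
  -- Passing the gate leads to a new repetition with probability `1 - θ.gate ^ (wordIndex w + 1)`,
  -- and there rejection has probability at least `r`.
  set β := (1 - (θ.gate : ℝ) ^ (wordIndex w + 1)) * r with hβd
  have hβ : β ≤ 1 := by nlinarith
  have hgate : ∀ j < (k + 1) ^ w.length, ∀ s, β ≤ val θ P w .reject (.gate true) 0 j s := by
    intro j hj s
    rw [val_gate θ P w (h := .reject) trivial hj, hβd]
    have h1 := mul_nonneg hq0 (val_nonneg θ P w .reject .accept 0 j s)
    have h2 := mul_le_mul_of_nonneg_left (hr (⟨j, hj⟩, s)) (sub_nonneg.2 hq1)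
    linarith
  rw [val_reset θ P w (h := .reject) trivial hj]
  obtain ⟨e, he⟩ := Nat.exists_eq_add_of_le hP
  obtain ⟨T, hT⟩ := Nat.exists_eq_succ_of_ne_zero
    (show (m + 1) ^ (7 * (wordIndex w + 1)) ≠ 0 by positivity)
  have h1 := sum_val_clock_ge_of_after θ P w hκ hβ hgate (n := T) (t := 0) (u := 0)
    (fun a s => sum_val_afterScan_ge θ P w hκ hβ hgate hgood T 0 (addToss 0 a) (by omega) s)
    (.reset :: s)
  simp only [storedAt_zero] at h1
  rw [le_div_iff₀ (by exact_mod_cast hB), add_mul, div_mul_cancel₀ _ (by exact_mod_cast hB.ne'), hT]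
  -- The `e` targets above the word index never meet the position and check nothing; they contribute
  -- only the general lower bound `β`.
  have h2 : (e : ℝ) * β ≤ ∑ u ∈ Finset.range e,
      val θ P w .reject (.clock (fun _ => (0, 0)) true) 0 (wordIndex w + 1 + u) (.reset :: s) := by
    have : ∀ u ∈ Finset.range e, β ≤
        val θ P w .reject (.clock (fun _ => (0, 0)) true) 0 (wordIndex w + 1 + u) (.reset :: s) := by
      intro u hu
      have := Finset.mem_range.1 hu
      have hlt : wordIndex w + 1 + u < (k + 1) ^ w.length := by omega
      exact le_val_clock θ P w hκ hlt hβ (hgate _ hlt) _ _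
    refine le_trans (le_of_eq ?_) (Finset.sum_le_sum this)
    simp
  have h3 : (((k + 1) ^ w.length : ℕ) : ℝ) = (wordIndex w + 1 : ℕ) + e := by
    rw [he]; push_cast; ring
  calc β * ((k + 1) ^ w.length : ℕ) + (1 - β) * goodProb θ.heads good T.succ 0
      = (wordIndex w + 1 : ℕ) * β + (1 - β) * goodProb θ.heads good (T + 1) 0 + e * β := by
        rw [h3]; ring
    _ ≤ _ := add_le_add h1 h2
    _ = _ := by rw [← Finset.sum_range_add, ← he]

/-- The numbers of tosses and of heads, and the number of digits dictated since, as a function of the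
sent symbols. -/
def bookkeeping : List (ProtocolSymbol m) → ℕ × ℕ × ℕ
  | [] => (0, 0, 0)
  | .reset :: _ => (0, 0, 0)
  | .announce a :: s => ((bookkeeping s).1 + 1, addToss (bookkeeping s).2.1 a, 0)
  | .query :: s => ((bookkeeping s).1, (bookkeeping s).2.1, (bookkeeping s).2.2 + 1)
  | .digits _ :: s => bookkeeping s

/-- The honest prover, which dictates the numbers of tosses and of heads. -/
def honest (m k : ℕ) : List (Fin k) → List (ProtocolSymbol m) → ProtocolSymbol m
  | _, .query :: s =>
    .digits (digitsAt m (bookkeeping s).2.2 (bookkeeping s).1 (bookkeeping s).2.1)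
  | _, _ => .reset

theorem bookkeeping_replicate_query (l : ℕ) (s : List (ProtocolSymbol m)) :
    bookkeeping (List.replicate l .query ++ s) =
      ((bookkeeping s).1, (bookkeeping s).2.1, (bookkeeping s).2.2 + l) := by
  induction l with
  | zero => rfl
  | succ l ih => rw [List.replicate_succ, List.cons_append, bookkeeping, ih]; rfl

theorem dictated_honest (s : List (ProtocolSymbol m)) (a : Bool) (l : ℕ) :
    dictated (honest m k) w (.announce a :: s) l =
      digitsAt m l ((bookkeeping s).1 + 1) (addToss (bookkeeping s).2.1 a) := by
  rw [dictated, List.replicate_succ, List.cons_append, honest, ProtocolSymbol.toDigits,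
    bookkeeping_replicate_query]
  simp [bookkeeping]

/-- A union bound in recursive form: each round costs at most one further clock probability. The
factor `Z` is the bound for acceptance at the gate. -/
theorem val_clock_honest_ge_of_after {j : ℕ} (hj : j < (k + 1) ^ w.length) {Z : ℝ} (hZ : 0 ≤ Z)
    {n t u : ℕ}
    (hafter : ∀ a s, bookkeeping s = (t + 1, addToss u a, 7 * (wordIndex w + 1)) →
      (goodProb θ.heads good n (addToss u a) - n * θ.clock ^ (wordIndex w + 1)) * Z ≤
        val θ (honest m k) w .accept (afterScan m (wordIndex w) j (t + 1) (addToss u a)) 0 j s)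
    {s : List (ProtocolSymbol m)} (hs1 : (bookkeeping s).1 = t) (hs2 : (bookkeeping s).2.1 = u) :
    (goodProb θ.heads good (n + 1) u - (n + 1 : ℕ) * θ.clock ^ (wordIndex w + 1)) * Z ≤
      val θ (honest m k) w .accept (.clock (storedAt m (wordIndex w) j t u) true) 0 j s := by
  obtain ⟨hα0, hα1⟩ := θ.heads.2
  obtain ⟨hκ0, hκ1⟩ := clock_pow_mem θ (wordIndex w + 1)
  have hY : ∀ a, (goodProb θ.heads good n (addToss u a) -
      n * θ.clock ^ (wordIndex w + 1)) * Z ≤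
      val θ (honest m k) w .accept
        (.query ⟨storedAt m (wordIndex w) j t u, 0, true, a, false⟩) 0 j (.announce a :: s) := by
    intro a
    rw [val_query_of_dictated_eq θ _ w (h := .accept) trivial hj
      (fun l _ => by rw [dictated_honest, hs1, hs2])]
    refine hafter a _ ?_
    rw [bookkeeping_replicate_query]
    simp [bookkeeping, hs1, hs2]
  have h1 := mul_le_mul_of_nonneg_left (hY true) hα0
  have h2 := mul_le_mul_of_nonneg_left (hY false) (sub_nonneg.2 hα1)
  rw [val_clock θ _ w (h := .accept) trivial _ hj, val_flip θ _ w (h := .accept) trivial]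
  have h3 := mul_nonneg hκ0 (val_nonneg θ (honest m k) w .accept .reject 0 j s)
  have h4 := mul_le_mul_of_nonneg_left (add_le_add h1 h2) (sub_nonneg.2 hκ1)
  refine le_trans ?_ ((le_add_of_nonneg_left h3).trans' h4)
  have hg := goodProb_le_one hα0 hα1 good (n + 1) u
  set κ := (θ.clock : ℝ) ^ (wordIndex w + 1)
  have h5 : (θ.heads : ℝ) * ((goodProb θ.heads good n (addToss u true) - n * κ) * Z) +
      (1 - θ.heads) * ((goodProb θ.heads good n (addToss u false) - n * κ) * Z) =
      (goodProb θ.heads good (n + 1) u - n * κ) * Z := by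
    simp only [goodProb, addToss, if_true, Bool.false_eq_true, if_false]
    ring
  rw [h5]
  -- This turns the product `(1 - κ) * (g - n * κ)` into the lower bound `g - (n + 1) * κ`, because
  -- `g - n * κ ≤ 1`.
  have h6 : 0 ≤ κ * (1 - (goodProb θ.heads good (n + 1) u - n * κ)) :=
    mul_nonneg hκ0 (by have : 0 ≤ n * κ := by positivity
                       linarith)
  have h7 := mul_nonneg h6 hZ
  push_cast
  nlinarith

theorem val_afterScan_honest_ge {j : ℕ} (hj : j < (k + 1) ^ w.length) {Z : ℝ} (hZ : 0 ≤ Z)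
    (hgate : ∀ s, Z ≤ val θ (honest m k) w .accept (.gate true) 0 j s)
    (hgood : ∀ u, good u → digit m (6 * (wordIndex w + 1) - 1) u = 2) (n t u : ℕ)
    (ht : t + 1 + n = (m + 1) ^ (7 * (wordIndex w + 1)))
    (s : List (ProtocolSymbol m)) (hs1 : (bookkeeping s).1 = t + 1)
    (hs2 : (bookkeeping s).2.1 = u) :
    (goodProb θ.heads good n u - n * θ.clock ^ (wordIndex w + 1)) * Z ≤
      val θ (honest m k) w .accept (afterScan m (wordIndex w) j (t + 1) u) 0 j s := by
  induction n generalizing t u s with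
  | zero =>
    rw [afterScan, if_pos (by rw [← ht])]
    by_cases hu : good u
    · rw [if_pos (hgood u hu), goodProb_zero_of hu]
      simpa using hgate s
    · rw [goodProb_zero_of_not hu]
      simpa using val_nonneg θ (honest m k) w .accept _ 0 j s
  | succ n ih =>
    have hnd : ¬ (m + 1) ^ (7 * (wordIndex w + 1)) ∣ t + 1 := by
      rw [← ht]
      intro hdvd
      have := Nat.le_of_dvd (Nat.succ_pos t) hdvd
      omega
    rw [afterScan, if_neg hnd]
    exact val_clock_honest_ge_of_after θ w hj hZ (fun a s hs => ih (t + 1) (addToss u a) (by omega) s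
      (by rw [hs]) (by rw [hs])) hs1 hs2

/-- With the honest prover, the probability of acceptance `r` at the start of a repetition satisfies a
recursive inequality if the good numbers of heads lead to the end of the repetition. -/
theorem completeness_bound (hgood : ∀ u, good u → digit m (6 * (wordIndex w + 1) - 1) u = 2) :
    ∃ r, 0 ≤ r ∧ r ≤ 1 ∧ r ≤ val θ (honest m k) w .accept .reset 0 0 [] ∧
      (goodProb θ.heads good ((m + 1) ^ (7 * (wordIndex w + 1))) 0 -
        ((m + 1) ^ (7 * (wordIndex w + 1)) : ℕ) * θ.clock ^ (wordIndex w + 1)) *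
      (θ.gate ^ (wordIndex w + 1) + (1 - θ.gate ^ (wordIndex w + 1)) * r) ≤ r := by
  obtain ⟨hq0, hq1⟩ := gate_pow_mem θ (wordIndex w + 1)
  have hB : 0 < (k + 1) ^ w.length := by positivity
  have : Nonempty {j // j < (k + 1) ^ w.length} := ⟨⟨0, hB⟩⟩
  obtain ⟨r, hr0, hr1, hr, hrz⟩ := exists_greatest_lower_bound
    (fun i : {j // j < (k + 1) ^ w.length} × List (ProtocolSymbol m) =>
      val θ (honest m k) w .accept .reset 0 i.1 i.2)
    (fun i => val_nonneg _ _ _ _ _ _ _ _) (fun i => val_le_one _ _ _ _ _ _ _ _)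
  refine ⟨r, hr0, hr1, hr (⟨0, hB⟩, []), hrz _ ?_⟩
  rintro ⟨⟨j, hj⟩, s⟩
  set Z := (θ.gate : ℝ) ^ (wordIndex w + 1) + (1 - (θ.gate : ℝ) ^ (wordIndex w + 1)) * r with hZd
  have hZ : 0 ≤ Z := add_nonneg hq0 (mul_nonneg (sub_nonneg.2 hq1) hr0)
  have hgate : ∀ j < (k + 1) ^ w.length, ∀ s,
      Z ≤ val θ (honest m k) w .accept (.gate true) 0 j s := by
    intro j hj s
    rw [val_gate θ _ w (h := .accept) trivial hj, hZd, val_accept, mul_one]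
    have h2 := mul_le_mul_of_nonneg_left (hr (⟨j, hj⟩, s)) (sub_nonneg.2 hq1)
    linarith
  rw [val_reset θ _ w (h := .accept) trivial hj]
  obtain ⟨T, hT⟩ := Nat.exists_eq_succ_of_ne_zero
    (show (m + 1) ^ (7 * (wordIndex w + 1)) ≠ 0 by positivity)
  rw [le_div_iff₀ (by exact_mod_cast hB), hT]
  have h1 : ∀ u ∈ Finset.range ((k + 1) ^ w.length),
      (goodProb θ.heads good (T + 1) 0 - (T + 1 : ℕ) * θ.clock ^ (wordIndex w + 1)) * Z ≤
        val θ (honest m k) w .accept (.clock (fun _ => (0, 0)) true) 0 u (.reset :: s) := by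
    intro u hu
    have hu' := Finset.mem_range.1 hu
    have := val_clock_honest_ge_of_after θ w hu' hZ (good := good) (n := T) (t := 0) (u := 0)
      (fun a s hs => val_afterScan_honest_ge θ w hu' hZ (hgate u hu') hgood T 0 (addToss 0 a)
        (by omega) s (by rw [hs]) (by rw [hs])) (s := .reset :: s) rfl rfl
    rwa [storedAt_zero] at this
  refine le_trans (le_of_eq ?_) (Finset.sum_le_sum h1)
  rw [Finset.sum_const, Finset.card_range, nsmul_eq_mul, mul_comm]

end Protocol

/-! ### Reading a digit of the bias from an approximate count -/

namespace DigitExpansion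

variable {b : ℕ} {c : ℕ → ℕ}

/-- The number `∑ c (i + n) / b ^ (n + 1)`. -/
noncomputable def tail (b : ℕ) (c : ℕ → ℕ) (i : ℕ) : ℝ :=
  ∑' n, (c (i + n) : ℝ) / (b : ℝ) ^ (n + 1)

/-- The number with the base `b` digits `c 0, …, c (i - 1)`, most significant digit first. -/
def prefixValue (b : ℕ) (c : ℕ → ℕ) : ℕ → ℕ
  | 0 => 0
  | i + 1 => b * prefixValue b c i + c i

theorem hasSum_two_div_pow (hb : 5 ≤ b) :
    HasSum (fun n : ℕ => (2 : ℝ) / (b : ℝ) ^ (n + 1)) (2 / (b - 1)) := by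
  have hb' : (5 : ℝ) ≤ b := by exact_mod_cast hb
  have h := (hasSum_geometric_of_lt_one (r := (b : ℝ)⁻¹) (by positivity)
    (inv_lt_one_of_one_lt₀ (by linarith))).mul_left (2 / (b : ℝ))
  have h1 : (b : ℝ) - 1 ≠ 0 := by linarith
  have h2 : 2 / (b : ℝ) * (1 - (b : ℝ)⁻¹)⁻¹ = 2 / (b - 1) := by
    rw [show (1 - (b : ℝ)⁻¹) = (b - 1) / b by field_simp, inv_div]
    field_simp
  rw [h2] at h
  have h3 : (fun n : ℕ => (2 : ℝ) / (b : ℝ) ^ (n + 1)) =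
      fun n : ℕ => 2 / (b : ℝ) * (b : ℝ)⁻¹ ^ n := by
    funext n
    rw [pow_succ', inv_pow]
    field_simp
  rwa [h3]

theorem summable_tail (hb : 5 ≤ b) (hc : ∀ i, c i ≤ 2) (i : ℕ) :
    Summable fun n : ℕ => (c (i + n) : ℝ) / (b : ℝ) ^ (n + 1) := by
  refine Summable.of_nonneg_of_le (fun n => by positivity) (fun n => ?_)
    (hasSum_two_div_pow hb).summable
  gcongr
  exact_mod_cast hc _

theorem tail_eq (hb : 5 ≤ b) (hc : ∀ i, c i ≤ 2) (i : ℕ) :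
    tail b c i = (c i + tail b c (i + 1)) / b := by
  rw [tail, (summable_tail hb hc i).tsum_eq_zero_add, tail, add_div, ← tsum_div_const]
  congr 1
  · simp
  · refine tsum_congr fun n => ?_
    rw [div_div, ← pow_succ, show i + (n + 1) = i + 1 + n by ring]

theorem tail_nonneg (i : ℕ) : 0 ≤ tail b c i :=
  tsum_nonneg fun n => by positivity

theorem tail_le_half (hb : 5 ≤ b) (hc : ∀ i, c i ≤ 2) (i : ℕ) : tail b c i ≤ 1 / 2 := by
  have hb' : (5 : ℝ) ≤ b := by exact_mod_cast hb
  have h1 : tail b c i ≤ 2 / (b - 1) := by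
    rw [← (hasSum_two_div_pow hb).tsum_eq]
    refine (summable_tail hb hc i).tsum_le_tsum (fun n => ?_) (hasSum_two_div_pow hb).summable
    gcongr
    exact_mod_cast hc _
  refine h1.trans ?_
  rw [div_le_div_iff₀ (by linarith) (by norm_num)]
  linarith

/-- Nonzero digits keep every remainder of the expansion away from 0, and `tail_le_half` keeps it
away from 1. An error below `1 / b` therefore cannot change the integer part. -/
theorem inv_le_tail (hb : 5 ≤ b) (hc : ∀ i, c i ≤ 2) (hc1 : ∀ i, 1 ≤ c i) (i : ℕ) :
    1 / (b : ℝ) ≤ tail b c i := by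
  rw [tail_eq hb hc]
  gcongr
  have h1 : (1 : ℝ) ≤ c i := by exact_mod_cast hc1 i
  linarith [tail_nonneg (b := b) (c := c) (i + 1)]

/-- Shifting by `i` digits splits the bias into the integer formed by its first `i` digits and the
remainder. -/
theorem pow_mul_tail_zero (hb : 5 ≤ b) (hc : ∀ i, c i ≤ 2) (i : ℕ) :
    (b : ℝ) ^ i * tail b c 0 = prefixValue b c i + tail b c i := by
  induction i with
  | zero => simp [prefixValue]
  | succ i ih =>
    have hb' : (b : ℝ) ≠ 0 := by have : 0 < b := by omega
                                 positivity
    rw [pow_succ', mul_assoc, ih, tail_eq hb hc i, prefixValue]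
    push_cast
    field_simp
    ring

theorem div_eq_prefixValue (hb : 5 ≤ b) (hc : ∀ i, c i ≤ 2) (hc1 : ∀ i, 1 ≤ c i) {i E u : ℕ}
    (hE : 0 < E) (hu : |(u : ℝ) - E * b ^ i * tail b c 0| < E / b) :
    u / E = prefixValue b c i := by
  have hb' : (5 : ℝ) ≤ b := by exact_mod_cast hb
  have hE' : (0 : ℝ) < E := by exact_mod_cast hE
  have h1 := inv_le_tail hb hc hc1 i
  have h2 := tail_le_half hb hc i
  rw [mul_assoc, pow_mul_tail_zero hb hc, abs_lt] at hu
  have h3 : (1 : ℝ) / b ≤ 1 / 2 := by gcongr; linarith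
  have h4 : (E : ℝ) / b = E * (1 / b) := by ring
  rw [h4] at hu
  refine Nat.div_eq_of_lt_le ?_ ?_
  · have : ((prefixValue b c i * E : ℕ) : ℝ) ≤ u := by
      push_cast
      nlinarith
    exact_mod_cast this
  · have : (u : ℝ) < (((prefixValue b c i + 1) * E : ℕ) : ℝ) := by
      push_cast
      nlinarith
    exact_mod_cast this

end DigitExpansion

open DigitExpansion in
-- Among `7 * M` digits of the count, dropping the lowest `6 * M - 1` leaves `M + 1`; these are `c
-- 0, …, c M`, and the last of them is the wanted one. The allowed deviation is one base-`b` place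
-- below that digit.
theorem digit_of_abs_lt {m : ℕ} {c : ℕ → ℕ} (hm : 4 ≤ m) (hc : ∀ i, c i ≤ 2)
    (hc1 : ∀ i, 1 ≤ c i) {M u : ℕ} (hM : 0 < M)
    (hu : |(u : ℝ) - ((m + 1 : ℕ) : ℝ) ^ (7 * M) * tail (m + 1) c 0| <
      ((m + 1 : ℕ) : ℝ) ^ (7 * M) / ((m + 1 : ℕ) : ℝ) ^ (M + 2)) :
    digit m (6 * M - 1) u = Fin.ofNat (m + 1) (c M) := by
  have hE : 0 < (m + 1) ^ (6 * M - 1) := by positivity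
  have hb0 : ((m + 1 : ℕ) : ℝ) ≠ 0 := by positivity
  have h7 : 7 * M = (6 * M - 1) + (M + 1) := by omega
  have h := div_eq_prefixValue (b := m + 1) (c := c) (i := M + 1) (u := u) (by omega) hc hc1 hE (by
    rw [h7, pow_add, pow_succ _ (M + 1), mul_comm (_ ^ (6 * M - 1)) (_ ^ (M + 1)),
      mul_div_mul_left _ _ (pow_ne_zero _ hb0), mul_comm (_ ^ (M + 1)) (_ ^ (6 * M - 1))] at hu
    rwa [Nat.cast_pow])
  rw [digit, h, prefixValue]
  simp [Fin.ext_iff, Nat.add_mod]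

/-! ### The coins for a language and the choice of constants -/

/-- The digits that encode a language: the digit with index `wordIndex w + 1` is `2` for the members
`w`; all other digits are `1`. -/
noncomputable def languageDigit {k : ℕ} (L : Language (Fin k)) (i : ℕ) : ℕ := by
  classical exact if ∃ w ∈ L, wordIndex w + 1 = i then 2 else 1

theorem languageDigit_wordIndex {k : ℕ} (L : Language (Fin k)) (w : List (Fin k)) :
    languageDigit L (wordIndex w + 1) = 2 ↔ w ∈ L := by
  rw [languageDigit]
  constructor
  · intro h
    split_ifs at h with hw
    · obtain ⟨v, hv, hvw⟩ := hw
      rwa [← wordIndex_injective (Nat.succ_injective hvw)]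
    · omega
  · intro hw
    rw [if_pos ⟨w, hw, rfl⟩]

theorem languageDigit_eq (k : ℕ) (L : Language (Fin k)) (i : ℕ) :
    languageDigit L i = 1 ∨ languageDigit L i = 2 := by
  rw [languageDigit]
  split_ifs <;> simp

namespace Protocol

open DigitExpansion

/-- The base of the dictated numbers, minus one. -/
abbrev base (k : ℕ) : ℕ := 60 * k + 59

theorem four_le_base (k : ℕ) : 4 ≤ base k := by
  unfold base
  omega

/-- The coins for a language. -/
noncomputable def languageCoins {k : ℕ} (L : Language (Fin k)) : ProtocolCoins where
  heads := ⟨tail (base k + 1) (languageDigit L) 0, tail_nonneg 0,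
    (tail_le_half (Nat.succ_le_succ (four_le_base k)) (fun i => by rcases languageDigit_eq k L i with h | h <;> omega) 0).trans
      (by norm_num)⟩
  -- The exponent 8 exceeds by one the 7 in the number `b ^ (7 * M)` of rounds, so the total clock
  -- risk of a repetition is at most `b ^ (-M)`.
  clock := ⟨1 / ((base k + 1 : ℕ) : ℝ) ^ 8, by positivity, by
    rw [div_le_one (by positivity)]
    exact_mod_cast Nat.one_le_pow _ _ (Nat.succ_pos _)⟩
  -- The factor `k + 1` makes acceptance rarer than hitting a given target; the 6 yields the error
  -- 1/4.
  gate := ⟨1 / (6 * (k + 1 : ℕ)), by positivity, by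
    rw [div_le_one (by positivity)]
    exact_mod_cast (by omega : 1 ≤ 6 * (k + 1))⟩

variable {k : ℕ} (L : Language (Fin k)) (w : List (Fin k))

/-- The numbers of heads that are close to their expectation. -/
def IsTypical (u : ℕ) : Prop :=
  |(u : ℝ) - ((base k + 1 : ℕ) : ℝ) ^ (7 * (wordIndex w + 1)) * (languageCoins L).heads| <
    ((base k + 1 : ℕ) : ℝ) ^ (7 * (wordIndex w + 1)) / ((base k + 1 : ℕ) : ℝ) ^ (wordIndex w + 1 + 2)

theorem digit_of_isTypical {u : ℕ} (hu : IsTypical L w u) :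
    digit (base k) (6 * (wordIndex w + 1) - 1) u = 2 ↔ w ∈ L := by
  have hb := four_le_base k
  have hd := fun i => languageDigit_eq k L i
  rw [digit_of_abs_lt (c := languageDigit L) hb
    (fun i => by rcases hd i with h | h <;> omega) (fun i => by rcases hd i with h | h <;> omega)
    (Nat.succ_pos _) hu, ← languageDigit_wordIndex L w]
  have h2 : (2 : Fin (base k + 1)) = Fin.ofNat (base k + 1) 2 := rfl
  rw [h2, Fin.ext_iff, Fin.val_ofNat, Fin.val_ofNat, Nat.mod_eq_of_lt, Nat.mod_eq_of_lt]
  · omega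
  · exact Nat.lt_succ_of_le ((by rcases hd (wordIndex w + 1) with h | h <;> omega :
      languageDigit L (wordIndex w + 1) ≤ 2).trans (by omega))

theorem goodProb_isTypical_ge :
    1 - (1 / ((base k + 1 : ℕ) : ℝ)) ^ (wordIndex w + 1) ≤
      goodProb (languageCoins L).heads (IsTypical L w)
        ((base k + 1) ^ (7 * (wordIndex w + 1))) 0 := by
  obtain ⟨h0, h1⟩ := (languageCoins L).heads.2
  set p : ℝ := ((languageCoins L).heads : ℝ)
  set M := wordIndex w + 1 with hM
  have hb1 : (1 : ℝ) ≤ ((base k + 1 : ℕ) : ℝ) := by exact_mod_cast Nat.succ_pos _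
  set b : ℝ := ((base k + 1 : ℕ) : ℝ) with hb
  have hb0 : 0 < b := by linarith
  have h := one_sub_goodProb_le (good := IsTypical L w) h0 h1 (c := b ^ (7 * M) * p)
    (D := b ^ (7 * M) / b ^ (M + 2)) (by positivity) (fun u hu => not_lt.1 hu)
    ((base k + 1) ^ (7 * M)) 0
  have hT : (((base k + 1) ^ (7 * M) : ℕ) : ℝ) = b ^ (7 * M) := by rw [Nat.cast_pow]
  rw [hT, Nat.cast_zero, zero_add, sub_self, zero_pow two_ne_zero, zero_add] at h
  have h2 : b ^ (7 * M) * (p * (1 - p)) / (b ^ (7 * M) / b ^ (M + 2)) ^ 2 ≤ (1 / b) ^ M := by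
    have hp : p * (1 - p) ≤ 1 := by nlinarith
    calc b ^ (7 * M) * (p * (1 - p)) / (b ^ (7 * M) / b ^ (M + 2)) ^ 2
        ≤ b ^ (7 * M) * 1 / (b ^ (7 * M) / b ^ (M + 2)) ^ 2 := by gcongr
      _ = b ^ (2 * (M + 2)) / b ^ (7 * M) := by
        rw [div_pow, ← pow_mul b (M + 2), mul_comm (M + 2) 2]
        field_simp
      _ ≤ (1 / b) ^ M := by
        rw [one_div, inv_pow, ← one_div, div_le_div_iff₀ (by positivity) (by positivity), one_mul,
          ← pow_add]
        -- The exponents satisfy `2 * (M + 2) + M ≤ 7 * M` because `M ≥ 1`; for `M = 1` this is an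
        -- equality, so seven phases are just enough.
        exact pow_le_pow_right₀ hb1 (by omega)
  linarith

/-- The base is ten times the reciprocal of the gate bias. Thus the bounds on atypical counts and on
the clock risk are each at most a tenth of the acceptance probability of a successful repetition. -/
theorem inv_base_pow_le :
    (1 / ((base k + 1 : ℕ) : ℝ)) ^ (wordIndex w + 1) ≤
      ((languageCoins L).gate : ℝ) ^ (wordIndex w + 1) / 10 := by
  have h1 : (1 / ((base k + 1 : ℕ) : ℝ)) = ((languageCoins L).gate : ℝ) * (1 / 10) := by
    have : ((base k + 1 : ℕ) : ℝ) = 60 * (k + 1 : ℕ) := by push_cast; ring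
    rw [this, languageCoins]
    simp only
    field_simp
    norm_num
  rw [h1, mul_pow]
  calc _ ≤ ((languageCoins L).gate : ℝ) ^ (wordIndex w + 1) * (1 / 10) := by
        refine mul_le_mul_of_nonneg_left ?_ (gate_pow_mem _ _).1
        exact pow_le_of_le_one (by norm_num) (by norm_num) (Nat.succ_ne_zero _)
    _ = _ := by ring

theorem gate_pow_le :
    ((languageCoins L).gate : ℝ) ^ (wordIndex w + 1) ≤ 1 / 6 / ((k + 1) ^ w.length : ℕ) := by
  have h1 : ((languageCoins L).gate : ℝ) = 1 / 6 * (1 / (k + 1 : ℕ)) := by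
    rw [languageCoins]
    simp only
    field_simp
  have hlen := length_le_wordIndex w
  have hk : (1 : ℝ) / (k + 1 : ℕ) ≤ 1 := by
    rw [div_le_one (by positivity)]
    exact_mod_cast Nat.succ_pos k
  rw [h1, mul_pow, div_eq_mul_one_div (1 / 6 : ℝ)]
  refine mul_le_mul (pow_le_of_le_one (by norm_num) (by norm_num) (Nat.succ_ne_zero _)) ?_ (by positivity)
    (by norm_num)
  calc (1 / ((k + 1 : ℕ) : ℝ)) ^ (wordIndex w + 1) ≤ (1 / ((k + 1 : ℕ) : ℝ)) ^ w.length :=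
        pow_le_pow_of_le_one (by positivity) hk (by omega)
    _ = _ := by rw [div_pow, one_pow, Nat.cast_pow]

theorem gate_pow_le_sixth : ((languageCoins L).gate : ℝ) ^ (wordIndex w + 1) ≤ 1 / 6 := by
  refine (gate_pow_le L w).trans (div_le_self (by norm_num) ?_)
  exact_mod_cast Nat.one_le_pow _ _ (Nat.succ_pos k)

theorem completeness (hw : w ∈ L) :
    3 / 4 ≤ val (languageCoins L) (honest (base k) k) w .accept .reset 0 0 [] := by
  obtain ⟨r, hr0, hr1, hr, hrec⟩ := completeness_bound (m := base k) (languageCoins L) w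
    (good := IsTypical L w) fun u hu => (digit_of_isTypical L w hu).2 hw
  refine le_trans ?_ hr
  have hq0 : 0 < ((languageCoins L).gate : ℝ) ^ (wordIndex w + 1) := by
    rw [languageCoins]
    positivity
  have hq1 := gate_pow_le_sixth L w
  have hd := inv_base_pow_le L w
  have hg := goodProb_isTypical_ge L w
  have hκ : (((base k + 1) ^ (7 * (wordIndex w + 1)) : ℕ) : ℝ) *
      ((languageCoins L).clock : ℝ) ^ (wordIndex w + 1) =
      (1 / ((base k + 1 : ℕ) : ℝ)) ^ (wordIndex w + 1) := by
    rw [Nat.cast_pow, pow_mul, ← mul_pow, languageCoins]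
    simp only
    congr 1
    field_simp
  rw [hκ] at hrec
  set q := ((languageCoins L).gate : ℝ) ^ (wordIndex w + 1)
  set d := (1 / ((base k + 1 : ℕ) : ℝ)) ^ (wordIndex w + 1)
  -- One tenth of `q` is lost to atypical counts and one tenth to the clock. Solving for `r` gives
  -- `(5 - q) / (6 - q)`, which exceeds 3/4.
  have h1 : (1 - q / 5) * (q + (1 - q) * r) ≤ r := by
    refine le_trans (mul_le_mul_of_nonneg_right ?_ ?_) hrec
    · linarith
    · exact add_nonneg hq0.le (mul_nonneg (by linarith) hr0)
  have h2 : q * (1 - q / 5) ≤ q * (r * (6 / 5 - q / 5)) := by linarith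
  have h3 := le_of_mul_le_mul_left h2 hq0
  nlinarith

theorem soundness (P : List (Fin k) → List (ProtocolSymbol (base k)) → ProtocolSymbol (base k))
    (hw : w ∉ L) : 3 / 4 ≤ val (languageCoins L) P w .reject .reset 0 0 [] := by
  obtain ⟨r, hr0, hr1, hr, hrec⟩ := soundness_bound (m := base k) (languageCoins L) P w
    (good := IsTypical L w) (by rw [languageCoins]; positivity)
    fun u hu h => hw ((digit_of_isTypical L w hu).1 h)
  refine le_trans ?_ hr
  have hq0 := (gate_pow_mem (languageCoins L) (wordIndex w + 1)).1
  have hq1 := gate_pow_le_sixth L w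
  have hq2 := gate_pow_le L w
  have hd := inv_base_pow_le L w
  have hg := goodProb_isTypical_ge L w
  set q := ((languageCoins L).gate : ℝ) ^ (wordIndex w + 1)
  set g := goodProb (languageCoins L).heads (IsTypical L w)
    ((base k + 1) ^ (7 * (wordIndex w + 1))) 0
  have hB : (0 : ℝ) < ((k + 1) ^ w.length : ℕ) := by positivity
  set η := 1 / (((k + 1) ^ w.length : ℕ) : ℝ) with hη
  have hη0 : 0 < η := by positivity
  rw [div_eq_mul_one_div _ (((k + 1) ^ w.length : ℕ) : ℝ), ← hη] at hrec hq2
  by_contra! hlt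
  have hg2 : 1 / 2 ≤ g := by linarith
  have h1 : 1 / 4 < 1 - (1 - q) * r := by nlinarith
  have h2 : 1 / 8 < (1 - (1 - q) * r) * g := by nlinarith
  have h3 : 1 / 8 * η < (1 - (1 - q) * r) * g * η := mul_lt_mul_of_pos_right h2 hη0
  -- With `r < 3 / 4` a repetition gains more than `η / 8` for rejection, while the gate loses at
  -- most `(1 / 6) * (3 / 4) * η = η / 8`. This contradicts the recursive inequality.
  have h4 : q * r ≤ 1 / 6 * η * (3 / 4) := by
    refine mul_le_mul hq2 hlt.le hr0 (by positivity)
  linarith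

end Protocol

theorem corollary2 (k : ℕ) (hk : 1 < k) (L : Language (Fin k)) :
    ∃ V : PTMVerifier (Fin k), V.IsLinearSpace ∧ V.VerifiesWithBoundedError L := by
  let G := protocol (Protocol.base k) (Protocol.languageCoins L)
  refine ⟨G.verifier k, G.isLinearSpace k, 1 / 4, by norm_num, by norm_num,
    ⟨Protocol.honest (Protocol.base k) k, fun w hw => ?_⟩, fun w hw P => ?_⟩
  · refine (G.verifier k).ofReal_le_acceptProb _ w ?_
    refine (by norm_num : (1 - 1 / 4 : ℝ) ≤ 3 / 4).trans ((Protocol.completeness L w hw).trans ?_)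
    exact (G.value_startConfig (k := k) _ w (h := .accept) trivial).ge
  · refine (G.verifier k).ofReal_le_rejectProb _ w ?_
    refine (by norm_num : (1 - 1 / 4 : ℝ) ≤ 3 / 4).trans ((Protocol.soundness L w P hw).trans ?_)
    exact (G.value_startConfig (k := k) _ w (h := .reject) trivial).ge
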